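/- All graphs are finite and simple. For graphs $H$ and $G$ let $\mathcal N(H,G)$ be the number of (not necessarily induced) subgraphs of $G$ isomorphic to $H$, and let $\mathrm{ex}(n,H,F)$ be the maximum of $\mathcal N(H,G)$ over all $F$-free graphs $G$ on $n$ vertices. A graph is complete $k$-partite if its vertex set can be partitioned into $k$ non-empty classes such that two vertices are adjacent if and only if they lie in different classes. The edit distance of two $n$-vertex graphs $G$ and $G'$ is the least number of edges that have to be deleted from and added to $G$ in order to obtain a graph isomorphic to $G'$. Let $2\le k\le r$ and let $H$ be a complete $k$-partite graph on $h$ vertices. Then $H$ is weakly $K_{r+1}$-Turán-stable. That is, $\chi(K_{r+1})=r+1$, $\chi(H)\le r$, and for every $\varepsilon>0$ there exist $\delta>0$ and $n_0$ such that for every $n\ge n_0$ and every $K_{r+1}$-free graph $G$ on $n$ vertices with $\mathcal N(H,G)\ge \mathrm{ex}(n,H,K_{r+1})-\delta n^h$, there is a complete $r$-partite graph $T$ on $n$ vertices such that the edit distance of $G$ and $T$ is at most $\varepsilon n^2$. -/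

import Mathlib

/-- `G` is a complete `k`-partite graph: its vertices split into exactly `k` non-empty classes,
and two vertices are adjacent if and only if they lie in different classes. -/
def IsCompletePartite {V : Type*} (G : SimpleGraph V) (k : ℕ) : Prop :=
  ∃ c : V → Fin k, Function.Surjective c ∧ ∀ u v, G.Adj u v ↔ c u ≠ c v

open Classical in
/-- The generalized Turán number `ex(n, H, F)`: the largest number of (not necessarily induced)
copies of `H` in an `F`-free graph on `n` vertices. -/
noncomputable def genExtremalNumber {W U : Type*} (n : ℕ) (H : SimpleGraph W)
    (F : SimpleGraph U) : ℕ :=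
  (Finset.univ.filter fun G : SimpleGraph (Fin n) => F.Free G).sup fun G => G.copyCount H

/-- The edit distance of two graphs on `V`: the least number of edges that have to be deleted from
and added to `G` in order to obtain a graph isomorphic to `G'`. -/
noncomputable def editDist {V : Type*} (G G' : SimpleGraph V) : ℕ :=
  sInf {m | ∃ G'' : SimpleGraph V, Nonempty (G'' ≃g G') ∧
    (symmDiff G.edgeSet G''.edgeSet).ncard = m}

/-- `H` is weakly `F`-Turán-stable, where `χ(F) = r + 1` and `χ(H) ≤ r`: for every `ε > 0` there is
a `δ > 0` such that, for all large `n`, every `F`-free graph `G` on `n` vertices with at least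
`ex(n, H, F) - δ n ^ |V(H)|` copies of `H` has edit distance at most `ε n ^ 2` from some complete
`r`-partite graph. -/
def WeaklyTuranStable {W U : Type*} [Fintype W] (H : SimpleGraph W) (F : SimpleGraph U) : Prop :=
  ∃ r : ℕ, F.chromaticNumber = r + 1 ∧ H.chromaticNumber ≤ r ∧
    ∀ ε : ℝ, 0 < ε → ∃ δ : ℝ, 0 < δ ∧ ∃ n₀ : ℕ, ∀ n : ℕ, n₀ ≤ n →
      ∀ G : SimpleGraph (Fin n), F.Free G →
        (genExtremalNumber n H F : ℝ) - δ * (n : ℝ) ^ Fintype.card W ≤ (G.copyCount H : ℝ) →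
        ∃ T : SimpleGraph (Fin n), IsCompletePartite T r ∧
          (editDist G T : ℝ) ≤ ε * (n : ℝ) ^ 2

/-! Copies are replaced by homomorphisms: `homs q G` has |Aut H| times as many elements as there are
copies of H in G, up to the O(n^(h-1)) maps that are not injective. Distances are measured by
`disagreements`, counted in ordered pairs.

The proof combines Zykov symmetrization with a local stability statement. For non-adjacent u and v,
either may be turned into a clone of the other. This keeps the graph K_{r+1}-free, and the two
resulting graphs have on average at least as many homomorphisms as G (`two_mul_card_homs_le`). If u
and v have different neighbourhoods, the number of homomorphisms from a cherry rises strictly on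
average, so it serves as a tie-breaker (`exists_clone_increase`). Where no clone helps,
non-adjacency is transitive and the graph is complete multipartite with at most r classes.

Symmetrization alone says nothing about the original graph. The missing link is a gap
(`exists_local_stability`): an almost extremal graph within ε₀n² of a complete r-partite graph is
already within Cδn² of one. A clone changes only O(n) pairs, too few to cross this gap. Hence a far
almost extremal graph that is best for the symmetrization order cannot exist (`homs_stability`).

For the gap, the classes are first shown to have linear size (`exists_part_size_bound`). Then
`exists_repartition` gives a partition whose inner edges are far fewer than its missing cross pairs.
Each missing pair, once added, gains order n^(h-2) homomorphisms, while each deleted inner edge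
loses at most that order. Almost extremality therefore bounds the number of missing pairs by O(δn²).
-/

namespace PartiteStability

open Finset Classical

/-! ### Homomorphism counts under a change of edges. -/

section

variable {V W ι : Type*}

/-- The complete multipartite graph whose classes are the fibres of `c`. -/
def partGraph (c : V → ι) : SimpleGraph V := (⊤ : SimpleGraph ι).comap c

@[simp] lemma partGraph_adj {c : V → ι} {x y : V} : (partGraph c).Adj x y ↔ c x ≠ c y := by
  simp [partGraph]

lemma partGraph_cliqueFree {r : ℕ} (c : V → Fin r) : (partGraph c).CliqueFree (r + 1) := by
  have h : (partGraph c).Colorable r := ⟨SimpleGraph.Coloring.mk c (by simp)⟩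
  exact h.cliqueFree (Nat.lt_succ_self r)

variable [Fintype V] [Fintype W]

/-- The homomorphisms into `G` from the complete multipartite graph with vertex set `W` whose
classes are the fibres of `q`. -/
noncomputable def homs (q : W → ι) (G : SimpleGraph V) : Finset (W → V) :=
  univ.filter fun φ => ∀ i j, q i ≠ q j → G.Adj (φ i) (φ j)

lemma mem_homs {q : W → ι} {G : SimpleGraph V} {φ : W → V} :
    φ ∈ homs q G ↔ ∀ i j, q i ≠ q j → G.Adj (φ i) (φ j) := by simp [homs]

/-- The ordered pairs that are adjacent in `G` but not in `G'`. -/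
noncomputable def diffPairs (G G' : SimpleGraph V) : Finset (V × V) :=
  univ.filter fun p => G.Adj p.1 p.2 ∧ ¬ G'.Adj p.1 p.2

lemma mem_diffPairs {G G' : SimpleGraph V} {p : V × V} :
    p ∈ diffPairs G G' ↔ G.Adj p.1 p.2 ∧ ¬ G'.Adj p.1 p.2 := by simp [diffPairs]

lemma card_filter_pair_mem_le {i j : W} (hij : i ≠ j) (P : Finset (V × V)) :
    #{φ : W → V | (φ i, φ j) ∈ P} ≤ #P * Fintype.card V ^ (Fintype.card W - 2) := by
  have hc : Fintype.card {w : W // w ≠ i ∧ w ≠ j} = Fintype.card W - 2 := by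
    rw [Fintype.card_subtype]
    have : (univ.filter fun w : W => w ≠ i ∧ w ≠ j) = univ \ {i, j} := by ext; simp
    rw [this, card_sdiff_of_subset (subset_univ _), card_pair hij, card_univ]
  have : #P * Fintype.card V ^ (Fintype.card W - 2) =
      #(P ×ˢ (univ : Finset ({w : W // w ≠ i ∧ w ≠ j} → V))) := by
    rw [card_product, card_univ, Fintype.card_fun, hc]
  rw [this]
  apply card_le_card_of_injOn (fun φ => ((φ i, φ j), fun w => φ w.1))
  · intro φ hφ
    simpa using hφ
  · intro φ _ ψ _ h
    simp only [Prod.mk.injEq] at h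
    funext w
    by_cases h1 : w = i
    · rw [h1]; exact h.1.1
    by_cases h2 : w = j
    · rw [h2]; exact h.1.2
    exact congrFun h.2 ⟨w, h1, h2⟩

/-- A lost homomorphism sends some cross pair of `W` to a lost pair; this is the union bound over
the cross pairs. -/
lemma card_homs_sdiff_le [DecidableEq (W → V)] (q : W → ι) (G G' : SimpleGraph V) :
    #(homs q G \ homs q G') ≤
      Fintype.card W ^ 2 * (#(diffPairs G G') * Fintype.card V ^ (Fintype.card W - 2)) := by
  have hsub : homs q G \ homs q G' ⊆
      ((univ : Finset (W × W)).filter fun p => q p.1 ≠ q p.2).biUnion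
      fun p => {φ : W → V | (φ p.1, φ p.2) ∈ diffPairs G G'} := by
    intro φ hφ
    rw [mem_sdiff, mem_homs, mem_homs] at hφ
    obtain ⟨h1, h2⟩ := hφ
    push Not at h2
    obtain ⟨i, j, hij, h⟩ := h2
    simp only [mem_biUnion, mem_filter, mem_univ, true_and, Prod.exists]
    exact ⟨i, j, hij, mem_diffPairs.2 ⟨h1 i j hij, h⟩⟩
  refine (card_le_card hsub).trans (card_biUnion_le.trans ?_)
  refine (sum_le_card_nsmul _ _
    (#(diffPairs G G') * Fintype.card V ^ (Fintype.card W - 2)) ?_).trans ?_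
  · intro p hp
    exact card_filter_pair_mem_le (fun h => (mem_filter.1 hp).2 (by rw [h])) _
  · rw [smul_eq_mul]
    apply Nat.mul_le_mul_right
    refine (card_le_univ _).trans ?_
    rw [Fintype.card_prod, sq]

lemma card_homs_add_card_sdiff [DecidableEq (W → V)] (q : W → ι) (G G' : SimpleGraph V) :
    #(homs q G) + #(homs q G' \ homs q G) = #(homs q G') + #(homs q G \ homs q G') := by
  have h1 := card_sdiff_add_card (homs q G') (homs q G)
  have h2 := card_sdiff_add_card (homs q G) (homs q G')
  rw [union_comm] at h2
  omega

lemma exists_injective_two {k r : ℕ} (hkr : k ≤ r) {a b : Fin k} (hab : a ≠ b) {x y : Fin r}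
    (hxy : x ≠ y) : ∃ σ : Fin k → Fin r, Function.Injective σ ∧ σ a = x ∧ σ b = y := by
  obtain ⟨τ, hτ⟩ : ∃ τ : Fin k → Fin r, Function.Injective τ :=
    ⟨Fin.castLE hkr, Fin.castLE_injective hkr⟩
  let e := Equiv.swap (τ a) x
  have hb : e (τ b) ≠ x := by
    intro h
    have : e (τ b) = e (τ a) := by rw [h]; simp [e]
    exact hab (hτ (e.injective this)).symm
  refine ⟨fun t => Equiv.swap (e (τ b)) y (e (τ t)), ?_, ?_, by simp⟩
  · exact (Equiv.injective _).comp (e.injective.comp hτ)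
  · have : e (τ a) = x := by simp [e]
    simp only [this]
    exact Equiv.swap_apply_of_ne_of_ne hb.symm hxy

/-- For each missing pair (v, w), send i to v and j to w, and every other vertex anywhere in the
class that an injection of the k classes into the r classes prescribes. These maps use the missing
pair, and different pairs give different maps. -/
lemma le_card_homs_partGraph_sdiff [DecidableEq (W → V)] {k r : ℕ} (hkr : k ≤ r)
    (q : W → Fin k) {i j : W} (hij : q i ≠ q j) (G : SimpleGraph V) (c : V → Fin r)
    (b : ℝ) (hb : 0 ≤ b)
    (hc : ∀ s, b ≤ #{v | c v = s}) :
    #(diffPairs (partGraph c) G) * b ^ (Fintype.card W - 2) ≤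
      #(homs q (partGraph c) \ homs q G) := by
  have hij' : i ≠ j := fun h => hij (by rw [h])
  have hmap : ∀ φ ∈ (homs q (partGraph c) \ homs q G).filter
      (fun φ => (φ i, φ j) ∈ diffPairs (partGraph c) G), (φ i, φ j) ∈ diffPairs (partGraph c) G :=
    fun φ hφ => (mem_filter.1 hφ).2
  have hle : #((homs q (partGraph c) \ homs q G).filter
      (fun φ => (φ i, φ j) ∈ diffPairs (partGraph c) G)) ≤ #(homs q (partGraph c) \ homs q G) :=
    card_filter_le _ _
  refine le_trans ?_ (Nat.cast_le.2 hle)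
  rw [card_eq_sum_card_fiberwise hmap, Nat.cast_sum, ← nsmul_eq_mul]
  apply card_nsmul_le_sum
  rintro ⟨v, w⟩ hvw
  obtain ⟨h1, h2⟩ := mem_diffPairs.1 hvw
  rw [partGraph_adj] at h1
  obtain ⟨σ, hσ, hσi, hσj⟩ := exists_injective_two hkr hij h1
  let S : W → Finset V := fun t => if t = i then {v} else if t = j then {w} else
    univ.filter fun x => c x = σ (q t)
  have hS : ∀ φ ∈ Fintype.piFinset S, φ i = v ∧ φ j = w ∧ ∀ t, c (φ t) = σ (q t) := by
    intro φ hφ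
    rw [Fintype.mem_piFinset] at hφ
    have hi : φ i = v := by simpa [S] using hφ i
    have hj : φ j = w := by simpa [S, hij'.symm] using hφ j
    refine ⟨hi, hj, fun t => ?_⟩
    by_cases hti : t = i
    · rw [hti, hi, hσi]
    by_cases htj : t = j
    · rw [htj, hj, hσj]
    simpa [S, hti, htj] using hφ t
  have hcard : b ^ (Fintype.card W - 2) ≤ #(Fintype.piFinset S) := by
    rw [Fintype.card_piFinset, Nat.cast_prod]
    rw [← prod_sdiff (subset_univ ({i, j} : Finset W)), prod_pair hij']
    have e1 : (#(S i) : ℝ) = 1 := by simp [S]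
    have e2 : (#(S j) : ℝ) = 1 := by simp [S, hij'.symm]
    rw [e1, e2, one_mul, mul_one]
    have : Fintype.card W - 2 = #(univ \ {i, j} : Finset W) := by
      rw [card_sdiff_of_subset (subset_univ _), card_pair hij', card_univ]
    rw [this, ← prod_const]
    apply prod_le_prod (fun _ _ => hb)
    intro t ht
    have : t ≠ i ∧ t ≠ j := by simpa using ht
    simpa [S, this.1, this.2] using hc (σ (q t))
  refine hcard.trans (Nat.cast_le.2 (card_le_card ?_))
  intro φ hφ
  obtain ⟨hi, hj, ht⟩ := hS φ hφ
  simp only [mem_filter, mem_sdiff, mem_homs, hi, hj, hvw, partGraph_adj, and_true]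
  refine ⟨fun s t hst => ?_, fun h => h2 ?_⟩
  · rw [ht, ht]
    exact fun h => hst (hσ h)
  · have := h i j hij
    rwa [hi, hj] at this

end

/-! ### Zykov symmetrization by cloning. -/

section

variable {V W ι : Type*}

lemma cliqueFree_comap {G : SimpleGraph V} {r : ℕ} (hG : G.CliqueFree r) (f : V → V) :
    (G.comap f).CliqueFree r := by
  rw [SimpleGraph.cliqueFree_iff] at hG ⊢
  refine ⟨fun e => hG.false
    ⟨⟨fun i => f (e i), fun {a b} h => e.toHom.map_adj h⟩, fun a b hab => ?_⟩⟩
  by_contra hne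
  have h : (G.comap f).Adj (e a) (e b) := e.toHom.map_adj hne
  exact (show G.Adj (f (e a)) (f (e b)) from h).ne hab

variable [Fintype V] [Fintype W]

lemma mem_homs_comap {q : W → ι} {G : SimpleGraph V} {f : V → V} {φ : W → V} :
    φ ∈ homs q (G.comap f) ↔ f ∘ φ ∈ homs q G := by simp [mem_homs]

/-- Since u and v are not adjacent, everything mapped to u or v lies in one class of `q`. The other
classes are then mapped to common neighbours of u and v, so images may be moved freely between u and
v. -/
lemma comp_mem_homs_of_hits {q : W → ι} {G : SimpleGraph V} {u v : V} (huv : ¬ G.Adj u v)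
    {f : V → V} (hf : ∀ x, x ≠ u → x ≠ v → f x = x) (hu : f u = u ∨ f u = v)
    (hv : f v = u ∨ f v = v) {φ : W → V} (hφ : φ ∈ homs q G) {s t : W} (hs : φ s = u)
    (ht : φ t = v) : f ∘ φ ∈ homs q G := by
  rw [mem_homs] at hφ ⊢
  have key : ∀ a b, q a ≠ q b → (φ a = u ∨ φ a = v) →
      G.Adj u (φ b) ∧ G.Adj v (φ b) := by
    intro a b hab ha
    have hst : q s = q t := by
      by_contra h
      exact huv (hs ▸ ht ▸ hφ s t h)
    have has : q a = q s := by
      rcases ha with ha | ha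
      · rw [hst]
        by_contra h
        exact huv (ha ▸ ht ▸ hφ a t h)
      · by_contra h
        exact huv (ha ▸ hs ▸ (hφ a s h).symm)
    have h1 : q s ≠ q b := has ▸ hab
    exact ⟨hs ▸ hφ s b h1, ht ▸ hφ t b (hst ▸ h1)⟩
  have key2 : ∀ a b, q a ≠ q b → (φ a = u ∨ φ a = v) → G.Adj (f (φ a)) (f (φ b)) := by
    intro a b hab ha
    obtain ⟨h1, h2⟩ := key a b hab ha
    rw [hf (φ b) h1.ne' h2.ne']
    rcases ha with ha | ha <;> rw [ha]
    · rcases hu with h | h <;> rw [h] <;> assumption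
    · rcases hv with h | h <;> rw [h] <;> assumption
  intro a b hab
  simp only [Function.comp]
  by_cases ha : φ a = u ∨ φ a = v
  · exact key2 a b hab ha
  by_cases hb : φ b = u ∨ φ b = v
  · exact (key2 b a hab.symm hb).symm
  push Not at ha hb
  rw [hf _ ha.1 ha.2, hf _ hb.1 hb.2]
  exact hφ a b hab

/-- If φ misses u or v, the two maps on the right are φ and its swap in some order. If φ hits both,
`comp_mem_homs_of_hits` applies: either both right-hand terms are 1, or neither φ nor its swap is a
homomorphism. -/
lemma indicator_symmetrize [DecidableEq V] (q : W → ι) {G : SimpleGraph V} {u v : V}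
    (huv : ¬ G.Adj u v)
    (φ : W → V) :
    (if φ ∈ homs q G then 1 else 0) + (if Equiv.swap u v ∘ φ ∈ homs q G then 1 else 0) ≤
      (if Function.update id v u ∘ φ ∈ homs q G then 1 else 0) +
        (if Function.update id u v ∘ φ ∈ homs q G then 1 else 0) := by
  by_cases hv : ∃ t, φ t = v
  swap
  · push Not at hv
    have h1 : Function.update id v u ∘ φ = φ := by
      funext t; simp [hv t]
    have h2 : Function.update id u v ∘ φ = Equiv.swap u v ∘ φ := by
      funext t; simp [Function.update_apply, hv t, Equiv.swap_apply_def]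
    rw [h1, h2]
  by_cases hu : ∃ t, φ t = u
  swap
  · push Not at hu
    have h1 : Function.update id u v ∘ φ = φ := by
      funext t; simp [hu t]
    have h2 : Function.update id v u ∘ φ = Equiv.swap u v ∘ φ := by
      funext t; simp [Function.update_apply, hu t, Equiv.swap_apply_def]
    rw [h1, h2, add_comm]
  obtain ⟨t, ht⟩ := hv
  obtain ⟨s, hs⟩ := hu
  by_cases hφ : φ ∈ homs q G
  · have h1 : Function.update id v u ∘ φ ∈ homs q G := by
      refine comp_mem_homs_of_hits huv ?_ ?_ ?_ hφ hs ht
      · intro x _ h; simp [h]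
      · by_cases h : u = v <;> simp [Function.update_apply]
      · simp
    have h2 : Function.update id u v ∘ φ ∈ homs q G := by
      refine comp_mem_homs_of_hits huv ?_ ?_ ?_ hφ hs ht
      · intro x h _; simp [h]
      · simp
      · by_cases h : u = v <;> simp [Function.update_apply]
    simp only [hφ, h1, h2, if_true]
    split_ifs <;> omega
  · have h2 : Equiv.swap u v ∘ φ ∉ homs q G := by
      intro h
      apply hφ
      have := comp_mem_homs_of_hits (f := Equiv.swap u v) huv ?_ (by simp) (by simp) h
        (s := t) (t := s) (by simp [ht]) (by simp [hs])
      · convert this using 1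
        funext a; simp
      · intro x hx hy; exact Equiv.swap_apply_of_ne_of_ne hx hy
    simp [hφ, h2]

lemma card_homs_eq_sum [DecidableEq V] (q : W → ι) (G : SimpleGraph V) :
    #(homs q G) = ∑ φ : W → V, if φ ∈ homs q G then 1 else 0 := by
  rw [card_eq_sum_ones, ← sum_filter, filter_univ_mem]

lemma two_mul_card_homs_eq_sum [DecidableEq V] (q : W → ι) (G : SimpleGraph V) (u v : V) :
    2 * #(homs q G) = ∑ φ : W → V, ((if φ ∈ homs q G then 1 else 0) +
      (if Equiv.swap u v ∘ φ ∈ homs q G then 1 else 0)) := by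
  rw [sum_add_distrib, two_mul, ← card_homs_eq_sum]
  congr 1
  rw [card_homs_eq_sum]
  exact (Equiv.sum_comp (Equiv.arrowCongr (Equiv.refl W) (Equiv.swap u v))
    (fun φ => if φ ∈ homs q G then 1 else 0)).symm

lemma card_homs_comap_eq_sum [DecidableEq V] (q : W → ι) (G : SimpleGraph V) (f : V → V) :
    #(homs q (G.comap f)) = ∑ φ : W → V, if f ∘ φ ∈ homs q G then 1 else 0 := by
  simp only [card_homs_eq_sum, mem_homs_comap]

lemma two_mul_card_homs_le [DecidableEq V] (q : W → ι) {G : SimpleGraph V} {u v : V}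
    (huv : ¬ G.Adj u v) :
    2 * #(homs q G) ≤ #(homs q (G.comap (Function.update id v u))) +
      #(homs q (G.comap (Function.update id u v))) := by
  rw [two_mul_card_homs_eq_sum q G u v, card_homs_comap_eq_sum, card_homs_comap_eq_sum,
    ← sum_add_distrib]
  exact sum_le_sum fun φ _ => indicator_symmetrize q huv φ

lemma two_mul_card_homs_lt [DecidableEq V] (q : W → ι) {G : SimpleGraph V} {u v : V}
    (huv : ¬ G.Adj u v)
    (φ : W → V) (h1 : φ ∉ homs q G) (h2 : Equiv.swap u v ∘ φ ∉ homs q G)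
    (h3 : Function.update id v u ∘ φ ∈ homs q G) :
    2 * #(homs q G) < #(homs q (G.comap (Function.update id v u))) +
      #(homs q (G.comap (Function.update id u v))) := by
  rw [two_mul_card_homs_eq_sum q G u v, card_homs_comap_eq_sum, card_homs_comap_eq_sum,
    ← sum_add_distrib]
  refine sum_lt_sum (fun φ _ => indicator_symmetrize q huv φ) ⟨φ, mem_univ _, ?_⟩
  simp only [h1, h2, h3, if_true, if_false]
  omega

/-- The classes of the path with two edges, centred at `0`. -/
def cherry (i : Fin 3) : Prop := i = 0

/-- The strict gain comes from the map with centre w and leaves u, v: neither it nor its swap is a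
homomorphism, but it becomes one when v is made a clone of u. -/
lemma two_mul_card_homs_cherry_lt [DecidableEq V] {G : SimpleGraph V} {u v w : V}
    (huv : ¬ G.Adj u v)
    (hu : G.Adj u w) (hv : ¬ G.Adj v w) :
    2 * #(homs cherry G) < #(homs cherry (G.comap (Function.update id v u))) +
      #(homs cherry (G.comap (Function.update id u v))) := by
  have hwu : w ≠ u := hu.ne'
  have hwv : w ≠ v := by rintro rfl; exact huv hu
  have huv' : u ≠ v := by rintro rfl; exact hv hu
  have h1 : ![w, u, v] ∉ homs cherry G := by
    intro h
    exact hv (mem_homs.1 h 2 0 (by simp [cherry]))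
  have h2 : Equiv.swap u v ∘ ![w, u, v] ∉ homs cherry G := by
    intro h
    have := mem_homs.1 h 1 0 (by simp [cherry])
    simp [Equiv.swap_apply_of_ne_of_ne hwu hwv] at this
    exact hv this
  have h3 : Function.update id v u ∘ ![w, u, v] ∈ homs cherry G := by
    rw [mem_homs]
    intro i j hij
    fin_cases i <;> fin_cases j <;>
      simp_all [cherry, G.adj_comm w u]
  exact two_mul_card_homs_lt cherry huv _ h1 h2 h3

/-- If two non-adjacent vertices of `G` have different neighbourhoods, then replacing one vertex by
a clone of a non-neighbour strictly increases a positive combination of the number of homomorphisms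
from a complete multipartite graph and the number of homomorphisms from a cherry. -/
lemma exists_clone_increase [DecidableEq V] (q : W → ι) {G : SimpleGraph V} {u v w : V}
    (huv : ¬ G.Adj u v)
    (hu : G.Adj u w) (hv : ¬ G.Adj v w) (K : ℕ) :
    ∃ x y, ¬ G.Adj x y ∧
      #(homs q G) * K + #(homs cherry G) <
      #(homs q (G.comap (Function.update id x y))) * K +
        #(homs cherry (G.comap (Function.update id x y))) := by
  have h1 := two_mul_card_homs_le q huv
  have h2 := two_mul_card_homs_cherry_lt huv hu hv
  have h3 := Nat.mul_le_mul_right K h1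
  by_contra hcon
  push Not at hcon
  -- The sum over the two clones exceeds twice the old value, so they cannot both fail to improve
  -- it.
  have h4 := hcon v u (fun h => huv h.symm)
  have h5 := hcon u v huv
  rw [add_mul, mul_assoc] at h3
  omega

end

/-! ### Clique transversals and disagreement with a partition. -/

section

variable {V ι : Type*}

lemma not_cliqueFree_of_transversal {r : ℕ} {G : SimpleGraph V} (x : V) (w : Fin r → V)
    (hx : ∀ a, G.Adj x (w a)) (hw : ∀ a b, a ≠ b → G.Adj (w a) (w b)) :
    ¬ G.CliqueFree (r + 1) := by
  have hinj : Function.Injective w := by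
    intro a b hab
    by_contra h
    exact (hw a b h).ne hab
  have h1 : G.IsNClique r (univ.image w) := by
    refine ⟨?_, by rw [card_image_of_injective _ hinj, card_univ, Fintype.card_fin]⟩
    rintro _ ha _ hb hne
    simp only [coe_image, coe_univ, Set.image_univ, Set.mem_range] at ha hb
    obtain ⟨a, rfl⟩ := ha
    obtain ⟨b, rfl⟩ := hb
    exact hw a b (fun h => hne (by rw [h]))
  have h2 := h1.insert (a := x) (by
    intro b hb
    simp only [mem_image, mem_univ, true_and] at hb
    obtain ⟨a, rfl⟩ := hb
    exact hx a)
  exact fun h => h _ h2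

/-- Greedy choice: a vertex picked from one set costs each remaining set at most g elements, and the
size required of these sets drops by g as well. -/
lemma exists_clique_transversal [Nonempty V] {G : SimpleGraph V} (g : ℝ) (hg : 0 ≤ g)
    (J : Finset ι) :
    ∀ A : ι → Finset V,
      (∀ a ∈ J, ∀ x ∈ A a, ∀ b ∈ J, a ≠ b → (#{y ∈ A b | ¬ G.Adj x y} : ℝ) ≤ g) →
      (∀ b ∈ J, (#J : ℝ) * g < #(A b)) →
      ∃ w : ι → V, (∀ a ∈ J, w a ∈ A a) ∧ ∀ a ∈ J, ∀ b ∈ J, a ≠ b → G.Adj (w a) (w b) := by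
  induction J using Finset.induction_on with
  | empty =>
    intro A _ _
    exact ⟨fun _ => Classical.arbitrary V, by simp, by simp⟩
  | insert a J ha ih =>
    intro A hA hcard
    have hcJ : (#(insert a J) : ℝ) = #J + 1 := by rw [card_insert_of_notMem ha]; push_cast; rfl
    rw [hcJ] at hcard
    have hpos : 0 < #(A a) := by
      have := hcard a (mem_insert_self a J)
      have h0 : (0 : ℝ) ≤ (#J + 1) * g := by positivity
      exact_mod_cast h0.trans_lt this
    obtain ⟨x, hx⟩ := card_pos.1 hpos
    obtain ⟨w, hw1, hw2⟩ := ih (fun b => {y ∈ A b | G.Adj x y}) (by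
      intro a' ha' x' hx' b hb hab
      refine le_trans (Nat.cast_le.2 (card_le_card ?_)) (hA a' (mem_insert_of_mem ha') x'
        (mem_filter.1 hx').1 b (mem_insert_of_mem hb) hab)
      intro y hy
      simp only [mem_filter] at hy ⊢
      exact ⟨hy.1.1, hy.2⟩) (by
      intro b hb
      have h1 := hcard b (mem_insert_of_mem hb)
      have h2 := hA a (mem_insert_self a J) x hx b (mem_insert_of_mem hb)
        (by rintro rfl; exact ha hb)
      have h3 := card_filter_add_card_filter_not (s := A b) (fun y => G.Adj x y)
      have h3' : (#{y ∈ A b | G.Adj x y} : ℝ) + #{y ∈ A b | ¬ G.Adj x y} = #(A b) := by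
        exact_mod_cast h3
      linarith)
    refine ⟨Function.update w a x, ?_, ?_⟩
    · intro b hb
      by_cases hba : b = a
      · subst hba; simpa using hx
      · rw [Function.update_of_ne hba]
        exact (mem_filter.1 (hw1 b ((mem_insert.1 hb).resolve_left hba))).1
    · intro b hb b' hb' hne
      by_cases hba : b = a
      · subst hba
        rw [Function.update_self, Function.update_of_ne hne.symm]
        exact (mem_filter.1 (hw1 b' ((mem_insert.1 hb').resolve_left hne.symm))).2
      · by_cases hba' : b' = a
        · subst hba'
          rw [Function.update_self, Function.update_of_ne hba]
          exact (mem_filter.1 (hw1 b ((mem_insert.1 hb).resolve_left hba))).2.symm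
        · rw [Function.update_of_ne hba, Function.update_of_ne hba']
          exact hw2 b ((mem_insert.1 hb).resolve_left hba) b'
            ((mem_insert.1 hb').resolve_left hba') hne

variable [Fintype V]

/-- The ordered pairs on which `G` differs from the complete multipartite graph with classes the
fibres of `c`. -/
noncomputable def disagreements (G : SimpleGraph V) (c : V → ι) : Finset (V × V) :=
  univ.filter fun p => ¬ (G.Adj p.1 p.2 ↔ c p.1 ≠ c p.2)

lemma mem_disagreements {G : SimpleGraph V} {c : V → ι} {p : V × V} :
    p ∈ disagreements G c ↔ ¬ (G.Adj p.1 p.2 ↔ c p.1 ≠ c p.2) := by simp [disagreements]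

/-- The number of pairs at `v` on which `G` differs from the complete multipartite graph obtained
from `c` by putting `v` into the class `s`. -/
noncomputable def vertexCost (G : SimpleGraph V) (c : V → ι) (v : V) (s : ι) : ℕ :=
  #{w | ¬ (G.Adj v w ↔ s ≠ c w)}

lemma card_filter_prod (P : V × V → Prop) [DecidablePred P] :
    #{p | P p} = ∑ v, #{w | P (v, w)} := by
  simp only [card_filter]
  rw [← univ_product_univ, sum_product]

lemma card_disagreements_eq_sum (G : SimpleGraph V) (c : V → ι) :
    #(disagreements G c) = ∑ v, vertexCost G c v (c v) := by
  unfold disagreements vertexCost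
  rw [card_filter_prod]

lemma card_disagreements_eq_add (G : SimpleGraph V) (c : V → ι) :
    #(disagreements G c) = #(diffPairs (partGraph c) G) + #(diffPairs G (partGraph c)) := by
  rw [← card_union_of_disjoint]
  · congr 1
    ext p
    simp only [disagreements, diffPairs, mem_filter, mem_univ, true_and, mem_union, partGraph_adj]
    tauto
  · rw [disjoint_left]
    intro p hp hp'
    rw [mem_diffPairs] at hp hp'
    exact hp.2 hp'.1

/-- Moving v affects only pairs that contain v. Each appears in both orders and the diagonal never
disagrees, so the total changes by exactly twice the change in the cost of v. -/
lemma vertexCost_le_of_minimal {G : SimpleGraph V} {c : V → ι}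
    (hc : ∀ c' : V → ι, #(disagreements G c) ≤ #(disagreements G c')) (v : V) (s : ι) :
    vertexCost G c v (c v) ≤ vertexCost G c v s := by
  have hsplit : ∀ S : Finset (V × V), #S = #{p ∈ S | p.1 = v} +
      (#{p ∈ {p ∈ S | ¬ p.1 = v} | p.2 = v} + #{p ∈ {p ∈ S | ¬ p.1 = v} | ¬ p.2 = v}) := by
    intro S
    rw [card_filter_add_card_filter_not, card_filter_add_card_filter_not]
  have hmin := hc (Function.update c v s)
  rw [hsplit (disagreements G c), hsplit (disagreements G (Function.update c v s))] at hmin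
  have e : {p ∈ {p ∈ disagreements G (Function.update c v s) | ¬ p.1 = v} | ¬ p.2 = v} =
      {p ∈ {p ∈ disagreements G c | ¬ p.1 = v} | ¬ p.2 = v} := by
    ext ⟨x, y⟩
    simp only [disagreements, mem_filter, mem_univ, true_and]
    constructor <;> rintro ⟨⟨h1, h2⟩, h3⟩ <;> refine ⟨⟨?_, h2⟩, h3⟩
    · simpa [Function.update_apply, h2, h3] using h1
    · simpa [Function.update_apply, h2, h3] using h1
  have h1 : vertexCost G c v (c v) ≤ #{p ∈ disagreements G c | p.1 = v} := by
    apply card_le_card_of_injOn (fun w => (v, w))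
    · intro w hw
      simpa [disagreements] using hw
    · intro a _ b _ h
      simpa using h
  have h2 : vertexCost G c v (c v) ≤ #{p ∈ {p ∈ disagreements G c | ¬ p.1 = v} | p.2 = v} := by
    apply card_le_card_of_injOn (fun w => (w, v))
    · intro w hw
      have hw' : ¬ (G.Adj v w ↔ c v ≠ c w) := by simpa using hw
      have : w ≠ v := by rintro rfl; simp at hw'
      simp only [disagreements, coe_filter, mem_filter, mem_univ, true_and, Set.mem_ofPred_eq, this,
        not_false_eq_true, and_true]
      rwa [G.adj_comm w v, ne_comm]
    · intro a _ b _ h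
      simpa using h
  have h3 : #{p ∈ disagreements G (Function.update c v s) | p.1 = v} ≤ vertexCost G c v s := by
    apply card_le_card_of_injOn Prod.snd
    · rintro ⟨x, y⟩ hp
      simp only [disagreements, coe_filter, mem_filter, mem_univ, true_and,
        Set.mem_ofPred_eq] at hp ⊢
      obtain ⟨hp, rfl⟩ := hp
      have hy : y ≠ x := by rintro rfl; simp at hp
      simpa [Function.update_apply, hy] using hp
    · rintro ⟨x, y⟩ hp ⟨x', y'⟩ hp' h
      simp only [coe_filter, Set.mem_ofPred_eq] at hp hp'
      exact Prod.ext (hp.2.trans hp'.2.symm) h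
  have h4 : #{p ∈ {p ∈ disagreements G (Function.update c v s) | ¬ p.1 = v} | p.2 = v} ≤
      vertexCost G c v s := by
    apply card_le_card_of_injOn Prod.fst
    · rintro ⟨x, y⟩ hp
      simp only [disagreements, coe_filter, mem_filter, mem_univ, true_and,
        Set.mem_ofPred_eq] at hp ⊢
      obtain ⟨⟨hp, hx⟩, rfl⟩ := hp
      rw [G.adj_comm, ne_comm] at hp
      simpa [Function.update_apply, hx] using hp
    · rintro ⟨x, y⟩ hp ⟨x', y'⟩ hp' h
      simp only [coe_filter, mem_filter, Set.mem_ofPred_eq] at hp hp'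
      exact Prod.ext h (hp.2.trans hp'.2.symm)
  rw [e] at hmin
  omega

end

/-! ### Repartitioning a graph close to complete r-partite. -/

section

variable {V : Type*} [Fintype V]

/-- A `K_{r+1}`-free graph close to a complete `r`-partite graph with large classes can be
repartitioned so that its edges inside the classes are few compared to the missing edges between
the classes. -/
lemma exists_repartition {r : ℕ} [Nonempty V] {G : SimpleGraph V} (hG : G.CliqueFree (r + 1))
    (c : V → Fin r) (hmin : ∀ c' : V → Fin r, #(disagreements G c) ≤ #(disagreements G c'))
    (n g₁ g₂ : ℝ) (hn : 0 < n) (hg₂ : 0 < g₂) (hg : (r + 2) * g₂ ≤ g₁ / 2)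
    (hD : (#(disagreements G c) : ℝ) ≤ g₂ ^ 2 * n ^ 2)
    (hpart : ∀ s, 8 * g₁ * n ≤ #{v | c v = s}) :
    ∃ c' : V → Fin r, ∃ B : ℝ, 0 ≤ B ∧ (∀ s, 4 * g₁ * n ≤ #{v | c' v = s}) ∧
      B * (g₁ / 2 * n) ≤ #(diffPairs (partGraph c') G) ∧
      (#(diffPairs G (partGraph c')) : ℝ) ≤ 2 * (B * ((r + 2) * g₂ * n)) := by
  have hr0 : (0 : ℝ) ≤ r := Nat.cast_nonneg r
  have hgn : 0 < g₂ * n := by positivity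
  have hrg : 0 ≤ r * (g₂ * n) := by positivity
  have hgg : (r + 2) * (g₂ * n) ≤ g₁ / 2 * n := by
    have := mul_le_mul_of_nonneg_right hg hn.le
    linarith
  have hg₁n : g₂ * n ≤ g₁ * n := by nlinarith
  -- `B₁` holds the vertices to be moved; the larger set `B₂` holds those not clean enough to be
  -- used in a transversal.
  set B₁ : Finset V := {v | g₁ * n ≤ vertexCost G c v (c v)} with hB₁
  set B₂ : Finset V := {v | g₂ * n ≤ vertexCost G c v (c v)} with hB₂
  have hB₁₂ : B₁ ⊆ B₂ := by
    intro v hv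
    simp only [hB₁, hB₂, mem_filter, mem_univ, true_and] at hv ⊢
    linarith
  have hcB₂ : (#B₂ : ℝ) ≤ g₂ * n := by
    have h1 : (#B₂ : ℝ) * (g₂ * n) ≤ #(disagreements G c) := by
      rw [card_disagreements_eq_sum, Nat.cast_sum, ← nsmul_eq_mul]
      refine (card_nsmul_le_sum B₂ (fun v => (vertexCost G c v (c v) : ℝ)) _ ?_).trans ?_
      · intro v hv
        simpa [hB₂] using hv
      · exact sum_le_sum_of_subset_of_nonneg (subset_univ _) (fun _ _ _ => Nat.cast_nonneg _)
    have h2 : (#B₂ : ℝ) * (g₂ * n) ≤ (g₂ * n) * (g₂ * n) := by nlinarith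
    exact le_of_mul_le_mul_right h2 hgn
  have hcB₁ : (#B₁ : ℝ) ≤ g₂ * n := (Nat.cast_le.2 (card_le_card hB₁₂)).trans hcB₂
  have hmiss : ∀ (x : V) (s : Fin r), s ≠ c x →
      #{y | c y = s ∧ ¬ G.Adj x y} ≤ vertexCost G c x (c x) := by
    intro x s hs
    apply card_le_card
    intro y hy
    simp only [mem_filter, mem_univ, true_and] at hy ⊢
    intro h
    exact hy.2 (h.2 (by rw [hy.1]; exact hs.symm))
  have hgood : ∀ x, x ∉ B₂ → (vertexCost G c x (c x) : ℝ) ≤ g₂ * n := by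
    intro x hx
    simp only [hB₂, mem_filter, mem_univ, true_and, not_le] at hx
    exact hx.le
  have hgood₁ : ∀ x, x ∉ B₁ → (vertexCost G c x (c x) : ℝ) ≤ g₁ * n := by
    intro x hx
    simp only [hB₁, mem_filter, mem_univ, true_and, not_le] at hx
    exact hx.le
  have htrans : ∀ (J : Finset (Fin r)) (A : Fin r → Finset V),
      (∀ a, ∀ x ∈ A a, c x = a ∧ x ∉ B₂) → (∀ b ∈ J, r * (g₂ * n) < #(A b)) →
      ∃ w : Fin r → V, (∀ a ∈ J, w a ∈ A a) ∧
        ∀ a ∈ J, ∀ b ∈ J, a ≠ b → G.Adj (w a) (w b) := by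
    intro J A hA hcard
    refine exists_clique_transversal (g₂ * n) hgn.le J A ?_ ?_
    · intro a _ x hx b _ hab
      refine le_trans (Nat.cast_le.2 ((card_le_card ?_).trans (hmiss x b ?_)))
        (hgood x (hA a x hx).2)
      · intro y hy
        simp only [mem_filter, mem_univ, true_and] at hy ⊢
        exact ⟨(hA b y hy.1).1, hy.2⟩
      · rw [(hA a x hx).1]; exact hab.symm
    · intro b hb
      refine lt_of_le_of_lt ?_ (hcard b hb)
      apply mul_le_mul_of_nonneg_right _ hgn.le
      exact_mod_cast (card_le_univ J).trans_eq (Fintype.card_fin r)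
  -- With many neighbours in all r classes, v would complete a clique transversal of its
  -- neighbourhood to a K_{r+1}.
  have hfew : ∀ v, ∃ i, (#{w | G.Adj v w ∧ c w = i} : ℝ) ≤ (r + 1) * (g₂ * n) := by
    intro v
    by_contra! hcon
    obtain ⟨w, hw1, hw2⟩ := htrans univ (fun i => {w | G.Adj v w ∧ c w = i ∧ w ∉ B₂})
      (by intro a x hx; simpa using (mem_filter.1 hx).2.2) (by
        intro i _
        have h1 : #{w | G.Adj v w ∧ c w = i} ≤ #{w | G.Adj v w ∧ c w = i ∧ w ∉ B₂} + #B₂ := by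
          refine (card_le_card ?_).trans (card_union_le _ _)
          intro w hw
          simp only [mem_filter, mem_univ, true_and, mem_union] at hw ⊢
          tauto
        have h1' : (#{w | G.Adj v w ∧ c w = i} : ℝ) ≤
            #{w | G.Adj v w ∧ c w = i ∧ w ∉ B₂} + #B₂ := by exact_mod_cast h1
        have h2 := hcon i
        linarith)
    refine not_cliqueFree_of_transversal v w (fun a => ?_)
      (fun a b => hw2 a (mem_univ a) b (mem_univ b)) hG
    exact (mem_filter.1 (hw1 a (mem_univ a))).2.1
  -- An edge inside a class and outside `B₁` would extend by common neighbours in the other r - 1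
  -- classes: of at least 8g₁n vertices there, only 2g₁n + g₂n are excluded.
  have hindep : ∀ u v, u ∉ B₁ → v ∉ B₁ → G.Adj u v → c u ≠ c v := by
    intro u v hu hv huv hcuv
    obtain ⟨w, hw1, hw2⟩ := htrans (univ.erase (c v))
      (fun i => {w | c w = i ∧ G.Adj u w ∧ G.Adj v w ∧ w ∉ B₂})
      (by intro a x hx; exact ⟨(mem_filter.1 hx).2.1, (mem_filter.1 hx).2.2.2.2⟩) (by
        intro i hi
        have hi' : i ≠ c v := (mem_erase.1 hi).1
        have h1 : #{w | c w = i} ≤ #{w | c w = i ∧ G.Adj u w ∧ G.Adj v w ∧ w ∉ B₂} +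
            (#{w | c w = i ∧ ¬ G.Adj u w} + (#{w | c w = i ∧ ¬ G.Adj v w} + #B₂)) := by
          refine le_trans (card_le_card ?_) ((card_union_le _ _).trans (Nat.add_le_add_left
            ((card_union_le _ _).trans (Nat.add_le_add_left (card_union_le _ _) _)) _))
          intro w hw
          simp only [mem_filter, mem_univ, true_and, mem_union] at hw ⊢
          tauto
        have h1' : (#{w | c w = i} : ℝ) ≤ #{w | c w = i ∧ G.Adj u w ∧ G.Adj v w ∧ w ∉ B₂} +
            (#{w | c w = i ∧ ¬ G.Adj u w} + (#{w | c w = i ∧ ¬ G.Adj v w} + #B₂)) := by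
          exact_mod_cast h1
        have h2 : (#{w | c w = i ∧ ¬ G.Adj u w} : ℝ) ≤ g₁ * n :=
          (Nat.cast_le.2 (hmiss u i (hcuv ▸ hi'))).trans (hgood₁ u hu)
        have h3 : (#{w | c w = i ∧ ¬ G.Adj v w} : ℝ) ≤ g₁ * n :=
          (Nat.cast_le.2 (hmiss v i hi')).trans (hgood₁ v hv)
        have h4 := hpart i
        linarith)
    have hw3 : ∀ a, a ≠ c v → G.Adj u (w a) ∧ G.Adj v (w a) := by
      intro a ha
      have := (mem_filter.1 (hw1 a (mem_erase.2 ⟨ha, mem_univ a⟩))).2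
      exact ⟨this.2.1, this.2.2.1⟩
    -- u fills the class omitted from the transversal, and v is the additional vertex.
    refine not_cliqueFree_of_transversal v (Function.update w (c v) u) ?_ ?_ hG
    · intro a
      by_cases ha : a = c v
      · subst ha; simpa using huv.symm
      · rw [Function.update_of_ne ha]; exact (hw3 a ha).2
    · intro a b hab
      by_cases ha : a = c v
      · subst ha
        rw [Function.update_self, Function.update_of_ne hab.symm]
        exact (hw3 b hab.symm).1
      · by_cases hb : b = c v
        · subst hb
          rw [Function.update_self, Function.update_of_ne hab]
          exact (hw3 a hab).1.symm
        · rw [Function.update_of_ne ha, Function.update_of_ne hb]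
          exact hw2 a (mem_erase.2 ⟨ha, mem_univ a⟩) b (mem_erase.2 ⟨hb, mem_univ b⟩) hab
  choose i hi using hfew
  let c' : V → Fin r := fun v => if v ∈ B₁ then i v else c v
  have hc'₁ : ∀ v ∈ B₁, c' v = i v := fun v hv => if_pos hv
  have hc'₂ : ∀ v ∉ B₁, c' v = c v := fun v hv => if_neg hv
  refine ⟨c', #B₁, Nat.cast_nonneg _, ?_, ?_, ?_⟩
  · intro s
    have h1 : #{v | c v = s} ≤ #{v | c' v = s} + #B₁ := by
      refine (card_le_card ?_).trans (card_union_le _ _)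
      intro v hv
      simp only [mem_filter, mem_univ, true_and, mem_union] at hv ⊢
      by_cases h : v ∈ B₁
      · exact Or.inr h
      · left; rw [hc'₂ v h]; exact hv
    have h1' : (#{v | c v = s} : ℝ) ≤ #{v | c' v = s} + #B₁ := by exact_mod_cast h1
    have := hpart s
    linarith
  -- By minimality, v in `B₁` still costs at least g₁n in its new class. Inner edges and other
  -- vertices of `B₁` account for at most (r+2)g₂n ≤ g₁n/2 of this; the rest are missing cross
  -- pairs.
  · unfold diffPairs
    rw [card_filter_prod, Nat.cast_sum, ← nsmul_eq_mul]
    refine le_trans ?_ (sum_le_sum_of_subset_of_nonneg (subset_univ B₁)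
      (fun _ _ _ => Nat.cast_nonneg _))
    apply card_nsmul_le_sum
    intro v hv
    have h1 : g₁ * n ≤ vertexCost G c v (c v) := by simpa [hB₁] using hv
    have h2 : (vertexCost G c v (c v) : ℝ) ≤ vertexCost G c v (i v) :=
      Nat.cast_le.2 (vertexCost_le_of_minimal hmin v (i v))
    have h3 : vertexCost G c v (i v) ≤ #{w | (partGraph c').Adj v w ∧ ¬ G.Adj v w} +
        (#{w | G.Adj v w ∧ c w = i v} + #B₁) := by
      refine le_trans (card_le_card ?_) ((card_union_le _ _).trans
        (Nat.add_le_add_left (card_union_le _ _) _))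
      intro w hw
      simp only [mem_filter, mem_univ, true_and, mem_union, partGraph_adj, hc'₁ v hv] at hw ⊢
      by_cases h : w ∈ B₁
      · exact Or.inr (Or.inr h)
      · rw [hc'₂ w h]
        by_cases h' : G.Adj v w
        · right; left
          refine ⟨h', ?_⟩
          by_contra h''
          exact hw ⟨fun _ => Ne.symm h'', fun _ => h'⟩
        · left
          refine ⟨fun h'' => hw ⟨fun h => absurd h h', fun h => absurd h'' h⟩, h'⟩
    have h3' : (vertexCost G c v (i v) : ℝ) ≤ #{w | (partGraph c').Adj v w ∧ ¬ G.Adj v w} +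
        (#{w | G.Adj v w ∧ c w = i v} + #B₁) := by exact_mod_cast h3
    have h4 := hi v
    linarith
  -- Every inner edge meets `B₁`, by `hindep`. The factor 2 in the bound covers the two orders of a
  -- pair.
  · have hdeg : ∀ v ∈ B₁, (#{w | G.Adj v w ∧ ¬ (partGraph c').Adj v w} : ℝ) ≤
        (r + 2) * g₂ * n := by
      intro v hv
      have h1 : #{w | G.Adj v w ∧ ¬ (partGraph c').Adj v w} ≤
          #{w | G.Adj v w ∧ c w = i v} + #B₁ := by
        refine (card_le_card ?_).trans (card_union_le _ _)
        intro w hw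
        simp only [mem_filter, mem_univ, true_and, mem_union, partGraph_adj, hc'₁ v hv,
          not_not] at hw ⊢
        by_cases h : w ∈ B₁
        · exact Or.inr h
        · rw [hc'₂ w h] at hw
          exact Or.inl ⟨hw.1, hw.2.symm⟩
      have h1' : (#{w | G.Adj v w ∧ ¬ (partGraph c').Adj v w} : ℝ) ≤
          #{w | G.Adj v w ∧ c w = i v} + #B₁ := by exact_mod_cast h1
      have h4 := hi v
      linarith
    have hfst : (#{p ∈ diffPairs G (partGraph c') | p.1 ∈ B₁} : ℝ) ≤
        #B₁ * ((r + 2) * g₂ * n) := by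
      have hmaps : ∀ p ∈ (diffPairs G (partGraph c')).filter (fun p => p.1 ∈ B₁), p.1 ∈ B₁ :=
        fun p hp => (mem_filter.1 hp).2
      rw [card_eq_sum_card_fiberwise hmaps, Nat.cast_sum, ← nsmul_eq_mul]
      apply sum_le_card_nsmul
      intro v hv
      refine le_trans (Nat.cast_le.2 ?_) (hdeg v hv)
      apply card_le_card_of_injOn Prod.snd
      · rintro ⟨x, y⟩ hp
        simp only [coe_filter, mem_filter, Set.mem_ofPred_eq, mem_diffPairs] at hp
        obtain ⟨⟨hp, -⟩, rfl⟩ := hp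
        simpa using hp
      · rintro ⟨x, y⟩ hp ⟨x', y'⟩ hp' h
        simp only [coe_filter, Set.mem_ofPred_eq] at hp hp'
        exact Prod.ext (hp.2.trans hp'.2.symm) h
    have hsnd : #{p ∈ diffPairs G (partGraph c') | p.2 ∈ B₁} ≤
        #{p ∈ diffPairs G (partGraph c') | p.1 ∈ B₁} := by
      apply card_le_card_of_injOn Prod.swap
      · rintro ⟨x, y⟩ hp
        simp only [coe_filter, Set.mem_ofPred_eq, mem_diffPairs, Prod.swap] at hp ⊢
        rw [G.adj_comm, (partGraph c').adj_comm]
        exact hp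
      · exact Prod.swap_injective.injOn
    have hcover : #(diffPairs G (partGraph c')) ≤
        #{p ∈ diffPairs G (partGraph c') | p.1 ∈ B₁} +
          #{p ∈ diffPairs G (partGraph c') | p.2 ∈ B₁} := by
      refine (card_le_card ?_).trans (card_union_le _ _)
      rintro ⟨x, y⟩ hp
      simp only [mem_union, mem_filter, hp, true_and]
      by_contra! h
      obtain ⟨h1, h2⟩ := mem_diffPairs.1 hp
      simp only [partGraph_adj, hc'₂ x h.1, hc'₂ y h.2, not_not] at h2
      exact hindep x y h.1 h.2 h1 h2
    have hcover' : (#(diffPairs G (partGraph c')) : ℝ) ≤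
        2 * #{p ∈ diffPairs G (partGraph c') | p.1 ∈ B₁} := by
      exact_mod_cast (hcover.trans (by omega))
    linarith

end

/-! ### Small classes and splitting a large class. -/

section

variable {V W κ : Type*} [Fintype W]

lemma pow_le_card_piFinset (q : W → κ) (S : κ → Finset V) {b : ℝ} (hb : 0 ≤ b)
    (hS : ∀ t, b ≤ #(S t)) : b ^ Fintype.card W ≤ #(Fintype.piFinset fun t => S (q t)) := by
  rw [Fintype.card_piFinset, Nat.cast_prod, ← card_univ, ← prod_const]
  exact prod_le_prod (fun _ _ => hb) (fun t _ => hS (q t))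

variable [Fintype V]

lemma card_filter_exists_mem_le (B : Finset V) :
    #{φ : W → V | ∃ t, φ t ∈ B} ≤
      Fintype.card W * (#B * Fintype.card V ^ (Fintype.card W - 1)) := by
  have hsub : ({φ : W → V | ∃ t, φ t ∈ B} : Finset (W → V)) ⊆
      univ.biUnion fun t : W => Fintype.piFinset fun s => if s = t then B else univ := by
    intro φ hφ
    simp only [mem_filter, mem_univ, true_and] at hφ
    obtain ⟨t, ht⟩ := hφ
    simp only [mem_biUnion, mem_univ, true_and, Fintype.mem_piFinset]
    refine ⟨t, fun s => ?_⟩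
    split_ifs with h
    · rwa [h]
    · exact mem_univ _
  refine (card_le_card hsub).trans (card_biUnion_le.trans ?_)
  refine (sum_le_card_nsmul _ _ (#B * Fintype.card V ^ (Fintype.card W - 1)) ?_).trans ?_
  · intro t _
    rw [Fintype.card_piFinset, ← mul_prod_erase univ _ (mem_univ t)]
    simp only [if_true]
    apply Nat.mul_le_mul_left
    rw [prod_congr rfl (g := fun _ => Fintype.card V)]
    · rw [prod_const, card_erase_of_mem (mem_univ t), card_univ]
    · intro s hs
      rw [if_neg (mem_erase.1 hs).1, card_univ]
  · rw [card_univ, smul_eq_mul]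

lemma card_homs_sdiff_le_of_card_diffPairs_le [DecidableEq (W → V)] (q : W → κ)
    (hW : 2 ≤ Fintype.card W)
    {G G' : SimpleGraph V} {d : ℝ} (hd : (#(diffPairs G G') : ℝ) ≤ d * (Fintype.card V : ℝ) ^ 2) :
    (#(homs q G \ homs q G') : ℝ) ≤
      (Fintype.card W : ℝ) ^ 2 * d * (Fintype.card V : ℝ) ^ Fintype.card W := by
  have h1 := card_homs_sdiff_le q G G'
  have h1' : (#(homs q G \ homs q G') : ℝ) ≤ (Fintype.card W : ℝ) ^ 2 *
      (#(diffPairs G G') * (Fintype.card V : ℝ) ^ (Fintype.card W - 2)) := by exact_mod_cast h1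
  have h2 : (Fintype.card V : ℝ) ^ Fintype.card W =
      (Fintype.card V : ℝ) ^ 2 * (Fintype.card V : ℝ) ^ (Fintype.card W - 2) := by
    rw [← pow_add]; congr 1; omega
  calc _ ≤ _ := h1'
    _ ≤ (Fintype.card W : ℝ) ^ 2 *
      (d * (Fintype.card V : ℝ) ^ 2 * (Fintype.card V : ℝ) ^ (Fintype.card W - 2)) := by gcongr
    _ = _ := by rw [h2]; ring

/-- Colouring by residues modulo r suffices. The resulting graph shows that almost extremal graphs
have order n^h homomorphisms. -/
lemma exists_balanced_coloring {r n : ℕ} (hr : 0 < r) (hn : r ≤ n) :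
    ∃ c : Fin n → Fin r, ∀ s, (n : ℝ) / (2 * r) ≤ #{v | c v = s} := by
  refine ⟨fun v => ⟨v % r, Nat.mod_lt _ hr⟩, fun s => ?_⟩
  have h1 : n / r ≤ #{v : Fin n | (⟨v % r, Nat.mod_lt _ hr⟩ : Fin r) = s} := by
    rw [← card_range (n / r)]
    have hlt : ∀ t ∈ range (n / r), t * r + s < n := by
      intro t ht
      have ht' : t + 1 ≤ n / r := mem_range.1 ht
      have h2 := Nat.mul_le_mul_right r ht'
      have h3 := Nat.div_mul_le_self n r
      have h4 := s.2
      rw [add_mul] at h2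
      omega
    -- The value 0 only makes the function total; by `hlt` it is never taken.
    refine card_le_card_of_injOn
      (fun t => if h : t * r + s < n then (⟨t * r + s, h⟩ : Fin n) else ⟨0, by omega⟩) ?_ ?_
    · intro t ht
      have hm := hlt t (by simpa using ht)
      simp only [coe_filter, mem_univ, true_and, Set.mem_ofPred_eq, hm, dif_pos]
      ext
      simp [Nat.mod_eq_of_lt s.2]
    · intro t ht t' ht' h
      have hm := hlt t (by simpa using ht)
      have hm' := hlt t' (by simpa using ht')
      simp only [hm, hm', dif_pos, Fin.mk.injEq, add_left_inj] at h
      exact Nat.eq_of_mul_eq_mul_right hr h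
  refine le_trans ?_ (Nat.cast_le.2 h1)
  have hr' : (0 : ℝ) < r := Nat.cast_pos.2 hr
  rw [div_le_iff₀ (by positivity)]
  have h2 : 1 ≤ n / r := (Nat.one_le_div_iff hr).2 hn
  have h3 : n < r * (n / r) + r := Nat.lt_mul_div_succ n hr |>.trans_eq (by ring)
  have h4 : n ≤ n / r * (2 * r) := by nlinarith
  exact_mod_cast h4

/-- If the sets `A j` lie in different fibres of `c'` and two of them lie in the same fibre of `c`,
then mapping the `j`-th class into `A j` gives homomorphisms that are not homomorphisms for `c`. -/
lemma pow_le_card_homs_sdiff [DecidableEq (W → V)] {k : ℕ} {ι : Type*} (q : W → Fin k)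
    (hq : Function.Surjective q) {c c' : V → ι} (A : Fin k → Finset V) (τ : Fin k → ι)
    (hτ : Function.Injective τ)
    (hA : ∀ j, ∀ x ∈ A j, c' x = τ j) {j₀ j₁ : Fin k} (hj : j₀ ≠ j₁) {p : ι}
    (h₀ : ∀ x ∈ A j₀, c x = p) (h₁ : ∀ x ∈ A j₁, c x = p) {b : ℝ} (hb : 0 ≤ b)
    (hcard : ∀ j, b ≤ #(A j)) :
    b ^ Fintype.card W ≤ #(homs q (partGraph c') \ homs q (partGraph c)) := by
  refine (pow_le_card_piFinset q A hb hcard).trans (Nat.cast_le.2 (card_le_card ?_))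
  intro φ hφ
  rw [Fintype.mem_piFinset] at hφ
  rw [mem_sdiff, mem_homs, mem_homs]
  constructor
  · intro x y hxy
    rw [partGraph_adj, hA _ _ (hφ x), hA _ _ (hφ y)]
    exact fun h => hxy (hτ h)
  · intro h
    obtain ⟨x, rfl⟩ := hq j₀
    obtain ⟨y, rfl⟩ := hq j₁
    have := h x y hj
    rw [partGraph_adj, h₀ _ (hφ x), h₁ _ (hφ y)] at this
    exact this rfl

/-- Classes smaller than β|V| contain fewer than about rβ|V| vertices together, so too few maps
touch them to account for all homomorphisms. -/
lemma exists_hom_avoiding_small {k r : ℕ} (q : W → Fin k) (hW : 2 ≤ Fintype.card W)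
    (c : V → Fin r) (hV : 0 < Fintype.card V) {β : ℝ} (hβ : 0 < β)
    (hlarge : (Fintype.card W : ℝ) * (r * β) * (Fintype.card V : ℝ) ^ Fintype.card W <
      #(homs q (partGraph c))) :
    ∃ φ ∈ homs q (partGraph c), ∀ t, β * Fintype.card V ≤ #{w | c w = c (φ t)} := by
  by_contra! hcon
  set B : Finset V := {v | (#{w | c w = c v} : ℝ) < β * Fintype.card V} with hB
  have hV' : (0 : ℝ) < Fintype.card V := Nat.cast_pos.2 hV
  have hBcard : (#B : ℝ) ≤ r * (β * Fintype.card V) := by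
    have hmaps : ∀ v ∈ B, c v ∈ (univ : Finset (Fin r)) := fun v _ => mem_univ _
    rw [card_eq_sum_card_fiberwise hmaps, Nat.cast_sum]
    refine (sum_le_card_nsmul _ _ (β * Fintype.card V) ?_).trans_eq (by simp)
    intro s _
    by_cases hs : ∃ v ∈ B, c v = s
    · obtain ⟨v, hv, rfl⟩ := hs
      have h1 : (#{w | c w = c v} : ℝ) < β * Fintype.card V := by simpa [hB] using hv
      refine le_trans (Nat.cast_le.2 (card_le_card ?_)) h1.le
      intro w hw
      simpa using (mem_filter.1 hw).2
    · rw [filter_eq_empty_iff.2]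
      · simp; positivity
      · intro v hv h
        exact hs ⟨v, hv, h⟩
  have hsub : homs q (partGraph c) ⊆ univ.filter (fun φ : W → V => ∃ t, φ t ∈ B) := by
    intro φ hφ
    obtain ⟨t, ht⟩ := hcon φ hφ
    simp only [mem_filter, mem_univ, true_and]
    exact ⟨t, by simpa [hB] using ht⟩
  have h1 := (card_le_card hsub).trans (card_filter_exists_mem_le B)
  have h1' : (#(homs q (partGraph c)) : ℝ) ≤
      Fintype.card W * (#B * (Fintype.card V : ℝ) ^ (Fintype.card W - 1)) := by exact_mod_cast h1
  have h2 : (Fintype.card V : ℝ) ^ Fintype.card W =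
      Fintype.card V * (Fintype.card V : ℝ) ^ (Fintype.card W - 1) := by
    rw [← pow_succ']; congr 1; omega
  have h3 : (Fintype.card W : ℝ) * (#B * (Fintype.card V : ℝ) ^ (Fintype.card W - 1)) ≤
      Fintype.card W * (r * (β * Fintype.card V) *
        (Fintype.card V : ℝ) ^ (Fintype.card W - 1)) := by gcongr
  rw [h2] at hlarge
  nlinarith

/-- If a class `s` of a complete `r`-partite graph is tiny, moving half of a large class to it
increases the number of homomorphisms substantially. -/
lemma exists_split_increase {k r : ℕ} (hk : 2 ≤ k) (q : W → Fin k) (hq : Function.Surjective q)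
    (hW : 2 ≤ Fintype.card W) (c : V → Fin r) {β b : ℝ} (hβ : 0 < β) (hbβ : b ≤ β)
    (hV : 2 ≤ β * Fintype.card V)
    {φ : W → V} (hφ : φ ∈ homs q (partGraph c))
    (hφβ : ∀ t, β * Fintype.card V ≤ #{w | c w = c (φ t)}) {s : Fin r}
    (hs : (#{w | c w = s} : ℝ) < b * Fintype.card V) :
    ∃ c' : V → Fin r, (#(homs q (partGraph c)) : ℝ) + (β / 4 * Fintype.card V) ^ Fintype.card W ≤
      #(homs q (partGraph c')) +
        (Fintype.card W : ℝ) ^ 2 * (2 * b) * (Fintype.card V : ℝ) ^ Fintype.card W := by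
  have hV0 : (0 : ℝ) ≤ Fintype.card V := Nat.cast_nonneg _
  choose w hw using hq
  set p : Fin k → Fin r := fun j => c (φ (w j)) with hp
  have hpinj : Function.Injective p := by
    intro a a' haa
    by_contra hne
    have := mem_homs.1 hφ (w a) (w a') (by rwa [hw, hw])
    rw [partGraph_adj] at this
    exact this haa
  have hpcard : ∀ j, β * Fintype.card V ≤ #{v | c v = p j} := fun j => hφβ (w j)
  have hps : ∀ j, p j ≠ s := by
    intro j h
    have h1 := hpcard j
    rw [h] at h1
    have := mul_le_mul_of_nonneg_right hbβ hV0
    linarith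
  let j₀ : Fin k := ⟨0, by omega⟩
  let j₁ : Fin k := ⟨1, by omega⟩
  have hj : j₀ ≠ j₁ := by simp [j₀, j₁]
  set P : Finset V := {v | c v = p j₀} with hP
  have hP2 : (2 : ℝ) ≤ #P := hV.trans (hpcard j₀)
  have hP2' : 2 ≤ #P := by exact_mod_cast hP2
  obtain ⟨S, hSP, hScard⟩ := exists_subset_card_eq (Nat.div_le_self #P 2)
  have hS1 : β / 4 * Fintype.card V ≤ #S := by
    have h1 : #P ≤ 4 * #S := by omega
    have h1' : (#P : ℝ) ≤ 4 * #S := by exact_mod_cast h1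
    have := hpcard j₀
    linarith
  have hS2 : β / 4 * Fintype.card V ≤ #(P \ S) := by
    have h1 : #P ≤ 4 * #(P \ S) := by rw [card_sdiff_of_subset hSP]; omega
    have h1' : (#P : ℝ) ≤ 4 * #(P \ S) := by exact_mod_cast h1
    have := hpcard j₀
    linarith
  have hSc : ∀ x ∈ S, c x = p j₀ := fun x hx => (mem_filter.1 (hSP hx)).2
  let c' : V → Fin r := fun v => if v ∈ S then s else c v
  -- New homomorphisms send class `j₀` to the half that stays and class `j₁` to the half that moves;
  -- the two halves were not joined before.
  have hgain : (β / 4 * Fintype.card V) ^ Fintype.card W ≤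
      #(homs q (partGraph c') \ homs q (partGraph c)) := by
    refine pow_le_card_homs_sdiff q (fun j => ⟨w j, hw j⟩)
      (fun j => if j = j₁ then S else univ.filter (fun v => c v = p j) \ S)
      (fun j => if j = j₁ then s else p j)
      ?_ ?_ hj (p := p j₀) ?_ ?_ (by positivity) ?_
    · intro a a' haa
      simp only at haa
      split_ifs at haa with h1 h2 h2
      · rw [h1, h2]
      · exact absurd haa.symm (hps a')
      · exact absurd haa (hps a)
      · exact hpinj haa
    · intro j x hx
      split_ifs at hx ⊢ with h1
      · exact if_pos hx
      · rw [mem_sdiff, mem_filter] at hx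
        simp only [c', if_neg hx.2, hx.1.2]
    · intro x hx
      rw [if_neg hj, mem_sdiff, mem_filter] at hx
      exact hx.1.2
    · intro x hx
      rw [if_pos rfl] at hx
      exact hSc x hx
    · intro j
      by_cases h1 : j = j₁
      · rw [if_pos h1]; exact hS1
      · rw [if_neg h1]
        by_cases h0 : j = j₀
        · rw [h0]; exact hS2
        · rw [sdiff_eq_self_of_disjoint]
          · have := hpcard j
            have h4 : 0 ≤ β * Fintype.card V := by positivity
            linarith
          · rw [disjoint_left]
            intro x hx hxS
            exact h0 (hpinj ((mem_filter.1 hx).2.symm.trans (hSc x hxS)))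
  -- The only edges lost join the moved half to the old tiny class `s`.
  have hloss : (#(homs q (partGraph c) \ homs q (partGraph c')) : ℝ) ≤
      (Fintype.card W : ℝ) ^ 2 * (2 * b) * (Fintype.card V : ℝ) ^ Fintype.card W := by
    apply card_homs_sdiff_le_of_card_diffPairs_le q hW
    have h1 : #(diffPairs (partGraph c) (partGraph c')) ≤
        #{v | c v = s} * Fintype.card V + Fintype.card V * #{v | c v = s} := by
      rw [← card_univ, ← card_product, ← card_product]
      refine (card_le_card ?_).trans (card_union_le _ _)
      rintro ⟨x, y⟩ hxy
      obtain ⟨h1, h2⟩ := mem_diffPairs.1 hxy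
      simp only [partGraph_adj, ne_eq, not_not, c'] at h1 h2
      simp only [mem_union, mem_product, mem_filter, mem_univ, true_and, and_true]
      split_ifs at h2 with hx hy hy
      · exact absurd ((hSc x hx).trans (hSc y hy).symm) h1
      · exact Or.inr h2.symm
      · exact Or.inl h2
      · exact absurd h2 h1
    have h1' : (#(diffPairs (partGraph c) (partGraph c')) : ℝ) ≤
        #{v | c v = s} * Fintype.card V + Fintype.card V * #{v | c v = s} := by exact_mod_cast h1
    nlinarith
  refine ⟨c', ?_⟩
  have := card_homs_add_card_sdiff q (partGraph c) (partGraph c')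
  have h' : (#(homs q (partGraph c)) : ℝ) + #(homs q (partGraph c') \ homs q (partGraph c)) =
      #(homs q (partGraph c')) + #(homs q (partGraph c) \ homs q (partGraph c')) := by
    exact_mod_cast this
  linarith

end

/-! ### Local stability and the symmetrization argument. -/

section

variable {W : Type*} [Fintype W]

/-- In a complete `r`-partite graph close to an almost extremal `K_{r+1}`-free graph all classes
have linear size. -/
lemma exists_part_size_bound {k r : ℕ} (hk : 2 ≤ k) (hkr : k ≤ r) (q : W → Fin k)
    (hq : Function.Surjective q) (hW : 2 ≤ Fintype.card W) :
    ∃ b : ℝ, 0 < b ∧ ∃ η : ℝ, 0 < η ∧ ∃ N : ℕ, ∀ n, N ≤ n → ∀ (G : SimpleGraph (Fin n)) (δ : ℝ),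
      δ ≤ η → (∀ G' : SimpleGraph (Fin n), G'.CliqueFree (r + 1) →
        (#(homs q G') : ℝ) ≤ #(homs q G) + δ * (n : ℝ) ^ Fintype.card W) →
      ∀ c : Fin n → Fin r, (#(disagreements G c) : ℝ) ≤ η * (n : ℝ) ^ 2 →
        ∀ s, b * n ≤ #{v | c v = s} := by
  have hr : 0 < r := by omega
  have hr' : (0 : ℝ) < r := Nat.cast_pos.2 hr
  set h := Fintype.card W with hh
  have hh' : (0 : ℝ) < h := Nat.cast_pos.2 (by omega)
  -- `a` is the homomorphism density of a balanced graph, and hrβ = a/4 leaves a homomorphism that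
  -- avoids small classes. `γ` is the gain from a split; `b` and `η` keep the losses below it.
  set a : ℝ := (1 / (2 * r)) ^ h with ha
  have ha0 : 0 < a := by positivity
  set β : ℝ := a / (4 * (h * r)) with hβ
  have hβ0 : 0 < β := by positivity
  set γ : ℝ := (β / 4) ^ h with hγ
  have hγ0 : 0 < γ := by positivity
  set b : ℝ := min β (γ / (8 * h ^ 2)) with hb
  have hb0 : 0 < b := lt_min hβ0 (by positivity)
  set η : ℝ := min a γ / (8 * h ^ 2) with hη
  have hη0 : 0 < η := div_pos (lt_min ha0 hγ0) (by positivity)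
  have hηa : h ^ 2 * η ≤ a / 8 := by
    have : (h : ℝ) ^ 2 * η = min a γ / 8 := by rw [hη]; field_simp
    rw [this]; linarith [min_le_left a γ]
  have hηγ : h ^ 2 * η ≤ γ / 8 := by
    have : (h : ℝ) ^ 2 * η = min a γ / 8 := by rw [hη]; field_simp
    rw [this]; linarith [min_le_right a γ]
  have hη1 : η ≤ h ^ 2 * η := by
    have : (1 : ℝ) ≤ h ^ 2 := one_le_pow₀ (by exact_mod_cast (by omega : 1 ≤ h))
    nlinarith
  have hbγ : h ^ 2 * (2 * b) ≤ γ / 4 := by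
    have h1 : b ≤ γ / (8 * h ^ 2) := min_le_right _ _
    have h2 : (h : ℝ) ^ 2 * (2 * (γ / (8 * h ^ 2))) = γ / 4 := by field_simp; norm_num
    rw [← h2]
    gcongr
  refine ⟨b, hb0, η, hη0, max r ⌈2 / β⌉₊, ?_⟩
  intro n hn G δ hδ hmax c hc s
  have hrn : r ≤ n := (le_max_left _ _).trans hn
  have hn0 : 0 < n := by omega
  have hn0' : (0 : ℝ) < n := Nat.cast_pos.2 hn0
  have hβn : 2 ≤ β * n := by
    have h1 : 2 / β ≤ n := (Nat.le_ceil _).trans (Nat.cast_le.2 ((le_max_right _ _).trans hn))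
    rw [div_le_iff₀ hβ0] at h1
    linarith
  have hp : (0 : ℝ) < (n : ℝ) ^ h := by positivity
  by_contra! hs
  have h1 : a * (n : ℝ) ^ h ≤ #(homs q G) + δ * (n : ℝ) ^ h := by
    obtain ⟨c₀, hc₀⟩ := exists_balanced_coloring hr hrn
    refine le_trans ?_ (hmax (partGraph c₀) (partGraph_cliqueFree c₀))
    have h2 := pow_le_card_piFinset q (fun j => univ.filter fun v => c₀ v = Fin.castLE hkr j)
      (b := (n : ℝ) / (2 * r)) (by positivity) (fun j => hc₀ _)
    rw [ha, ← mul_pow, one_div, inv_mul_eq_div]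
    refine h2.trans (Nat.cast_le.2 (card_le_card ?_))
    intro φ hφ
    rw [Fintype.mem_piFinset] at hφ
    rw [mem_homs]
    intro x y hxy
    rw [partGraph_adj, (mem_filter.1 (hφ x)).2, (mem_filter.1 (hφ y)).2]
    exact fun h => hxy (Fin.castLE_injective hkr h)
  have h2 : (#(homs q G) : ℝ) ≤ #(homs q (partGraph c)) + h ^ 2 * η * (n : ℝ) ^ h := by
    have h3 := card_homs_sdiff_le_of_card_diffPairs_le q hW (G := G) (G' := partGraph c)
      (d := η) (by
      rw [Fintype.card_fin]
      refine le_trans (Nat.cast_le.2 ?_) hc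
      rw [card_disagreements_eq_add]
      omega)
    rw [Fintype.card_fin] at h3
    have h4 := card_homs_add_card_sdiff q G (partGraph c)
    have h4' : (#(homs q G) : ℝ) + #(homs q (partGraph c) \ homs q G) =
      #(homs q (partGraph c)) + #(homs q G \ homs q (partGraph c)) := by exact_mod_cast h4
    have h5 : (0 : ℝ) ≤ #(homs q (partGraph c) \ homs q G) := Nat.cast_nonneg _
    linarith
  have h3 : (h : ℝ) * (r * β) * (n : ℝ) ^ h < #(homs q (partGraph c)) := by
    have e : (h : ℝ) * (r * β) = a / 4 := by rw [hβ]; field_simp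
    rw [e]
    have e2 := mul_le_mul_of_nonneg_right hηa hp.le
    have e3 := mul_le_mul_of_nonneg_right (hδ.trans (hη1.trans hηa)) hp.le
    have e4 := mul_pos ha0 hp
    linarith
  obtain ⟨φ, hφ, hφβ⟩ := exists_hom_avoiding_small q hW c (by rw [Fintype.card_fin]; exact hn0)
    hβ0 (by rw [Fintype.card_fin]; exact h3)
  obtain ⟨c', hc'⟩ := exists_split_increase hk q hq hW c hβ0 (min_le_left _ _ : b ≤ β)
    (by rw [Fintype.card_fin]; exact hβn) hφ hφβ (s := s) (by rw [Fintype.card_fin]; exact hs)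
  rw [Fintype.card_fin, mul_pow, ← hh, ← hγ] at hc'
  have h4 := hmax (partGraph c') (partGraph_cliqueFree c')
  have e2 := mul_le_mul_of_nonneg_right hηγ hp.le
  have e3 := mul_le_mul_of_nonneg_right (hδ.trans (hη1.trans hηγ)) hp.le
  have e5 := mul_le_mul_of_nonneg_right hbγ hp.le
  have e4 := mul_pos hγ0 hp
  linarith

/-- Stability for almost extremal `K_{r+1}`-free graphs that are already close to a complete
`r`-partite graph. -/
lemma exists_local_stability {k r : ℕ} (hk : 2 ≤ k) (hkr : k ≤ r) (q : W → Fin k)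
    (hq : Function.Surjective q) (hW : 2 ≤ Fintype.card W) :
    ∃ ε₀ : ℝ, 0 < ε₀ ∧ ∃ δ₀ : ℝ, 0 < δ₀ ∧ ∃ C : ℝ, 0 < C ∧ ∃ N : ℕ, ∀ n, N ≤ n →
      ∀ (G : SimpleGraph (Fin n)) (δ : ℝ), G.CliqueFree (r + 1) → δ ≤ δ₀ →
      (∀ G' : SimpleGraph (Fin n), G'.CliqueFree (r + 1) →
        (#(homs q G') : ℝ) ≤ #(homs q G) + δ * (n : ℝ) ^ Fintype.card W) →
      ∀ c : Fin n → Fin r, (#(disagreements G c) : ℝ) ≤ ε₀ * (n : ℝ) ^ 2 →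
        ∃ c' : Fin n → Fin r, (#(disagreements G c') : ℝ) ≤ C * δ * (n : ℝ) ^ 2 := by
  obtain ⟨b, hb, η, hη, N, hN⟩ := exists_part_size_bound hk hkr q hq hW
  set h := Fintype.card W with hh
  have hh' : (0 : ℝ) < h := Nat.cast_pos.2 (by omega)
  -- g₁ matches the class size 8g₁n in `exists_repartition`. `K` is the gain per missing pair, in
  -- units of n^(h-2), and `m` makes the loss from inner edges at most half of the total gain.
  set g₁ : ℝ := b / 8 with hg₁
  have hg₁0 : 0 < g₁ := by positivity
  set K : ℝ := (4 * g₁) ^ (h - 2) with hK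
  have hK0 : 0 < K := by positivity
  set m : ℝ := min 1 (K / h ^ 2) with hm
  have hm0 : 0 < m := lt_min one_pos (by positivity)
  have hm1 : m ≤ 1 := min_le_left _ _
  have hmK : h ^ 2 * m ≤ K := by
    have : m ≤ K / h ^ 2 := min_le_right _ _
    rw [le_div_iff₀ (by positivity)] at this
    linarith
  set g₂ : ℝ := g₁ * m / (8 * (r + 2)) with hg₂
  have hg₂0 : 0 < g₂ := by positivity
  have hg₂' : (r + 2) * g₂ = g₁ * m / 8 := by rw [hg₂]; field_simp
  refine ⟨min η (g₂ ^ 2), lt_min hη (by positivity), η, hη, 4 / K, by positivity, max N 1, ?_⟩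
  intro n hn G δ hG hδ hmax c hc
  have hNn : N ≤ n := (le_max_left _ _).trans hn
  have hn1 : 1 ≤ n := (le_max_right _ _).trans hn
  have hn0 : (0 : ℝ) < n := Nat.cast_pos.2 hn1
  have : Nonempty (Fin n) := ⟨⟨0, hn1⟩⟩
  have : Nonempty (Fin n → Fin r) := ⟨c⟩
  obtain ⟨c₀, hc₀⟩ := Finite.exists_min fun c : Fin n → Fin r => #(disagreements G c)
  have hc₀' : (#(disagreements G c₀) : ℝ) ≤ min η (g₂ ^ 2) * (n : ℝ) ^ 2 :=
    (Nat.cast_le.2 (hc₀ c)).trans hc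
  have hpart := hN n hNn G δ hδ hmax c₀ (hc₀'.trans (by gcongr; exact min_le_left _ _))
  obtain ⟨c', B, hB, hpart', hX, hY⟩ := exists_repartition hG c₀ hc₀ n g₁ g₂ hn0 hg₂0
    (by rw [hg₂']; nlinarith) (hc₀'.trans (by gcongr; exact min_le_right _ _))
    (by intro s; have := hpart s; rw [hg₁]; linarith)
  refine ⟨c', ?_⟩
  set X : ℝ := (#(diffPairs (partGraph c') G) : ℝ) with hXdef
  set Y : ℝ := (#(diffPairs G (partGraph c')) : ℝ) with hYdef
  have hX0 : 0 ≤ X := Nat.cast_nonneg _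
  have hYX : Y ≤ m / 2 * X := by
    have h1 := mul_le_mul_of_nonneg_left hX (by positivity : 0 ≤ m / 2)
    rw [hg₂'] at hY
    linarith
  obtain ⟨i, hi⟩ := hq ⟨0, by omega⟩
  obtain ⟨j, hj⟩ := hq ⟨1, by omega⟩
  have hij : q i ≠ q j := by rw [hi, hj]; simp
  have hgain := le_card_homs_partGraph_sdiff hkr q hij G c' (4 * g₁ * n) (by positivity) hpart'
  rw [mul_pow, ← hh, ← hK, ← hXdef] at hgain
  have hloss := card_homs_sdiff_le q G (partGraph c')
  rw [Fintype.card_fin, ← hh] at hloss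
  have hloss' : (#(homs q G \ homs q (partGraph c')) : ℝ) ≤
      (h : ℝ) ^ 2 * (Y * (n : ℝ) ^ (h - 2)) := by rw [hYdef]; exact_mod_cast hloss
  have hp : (0 : ℝ) < (n : ℝ) ^ (h - 2) := by positivity
  have hbal := card_homs_add_card_sdiff q G (partGraph c')
  have hbal' : (#(homs q G) : ℝ) + #(homs q (partGraph c') \ homs q G) =
      #(homs q (partGraph c')) + #(homs q G \ homs q (partGraph c')) := by exact_mod_cast hbal
  have hext := hmax (partGraph c') (partGraph_cliqueFree c')
  have hpow : (n : ℝ) ^ h = (n : ℝ) ^ 2 * (n : ℝ) ^ (h - 2) := by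
    rw [← pow_add]; congr 1; omega
  have hYK : (h : ℝ) ^ 2 * Y ≤ K / 2 * X := by
    have h1 := mul_le_mul_of_nonneg_left hYX (by positivity : (0 : ℝ) ≤ h ^ 2)
    have h2 := mul_le_mul_of_nonneg_right hmK hX0
    linarith
  have hYK' := mul_le_mul_of_nonneg_right hYK hp.le
  -- Passing to the complete r-partite graph gains K·X and loses at most half of that, while almost
  -- extremality caps the net gain.
  have hXδ : K / 2 * X ≤ δ * (n : ℝ) ^ 2 := by
    refine le_of_mul_le_mul_right ?_ hp
    rw [hpow] at hext
    linarith
  rw [card_disagreements_eq_add]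
  push_cast
  rw [← hXdef, ← hYdef]
  have hY1 : Y ≤ X := by nlinarith
  have hX2 : X ≤ 2 / K * (δ * (n : ℝ) ^ 2) := by
    rw [div_mul_eq_mul_div, le_div_iff₀ hK0]
    linarith
  have e : 4 / K * δ * (n : ℝ) ^ 2 = 2 * (2 / K * (δ * (n : ℝ) ^ 2)) := by ring
  linarith

/-- Non-adjacency is an equivalence relation, and representatives of its classes form a clique, so
there are at most r classes. -/
lemma exists_coloring_of_transitive {V : Type*} {r : ℕ} [Finite V] {G : SimpleGraph V}
    (hG : G.CliqueFree (r + 1)) (htr : ∀ u v w, ¬ G.Adj u v → G.Adj u w → G.Adj v w) :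
    ∃ c : V → Fin r, ∀ x y, G.Adj x y ↔ c x ≠ c y := by
  let S : Setoid V :=
    { r := fun x y => ¬ G.Adj x y
      iseqv := ⟨fun x => G.loopless.irrefl x, fun h h' => h h'.symm,
        fun {x y z} h h' hxz => h' (htr x y z h hxz)⟩ }
  have : Fintype (Quotient S) := Fintype.ofFinite _
  have hcard : Fintype.card (Quotient S) ≤ r := by
    by_contra! hlt
    obtain ⟨e⟩ : Nonempty (Fin (r + 1) ↪ Quotient S) :=
      Function.Embedding.nonempty_of_card_le (by rw [Fintype.card_fin]; exact hlt)
    rw [SimpleGraph.cliqueFree_iff] at hG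
    have hadj : ∀ a b, a ≠ b → G.Adj (e a).out (e b).out := by
      intro a b hab
      by_contra hn
      refine hab (e.injective ?_)
      rw [← Quotient.out_eq (e a), ← Quotient.out_eq (e b)]
      exact Quotient.sound hn
    refine hG.false ⟨⟨fun a => (e a).out, fun {a b} h => hadj a b h⟩, fun a b hab => ?_⟩
    by_contra hne
    exact (hadj a b hne).ne hab
  obtain ⟨e⟩ : Nonempty (Quotient S ↪ Fin r) :=
    Function.Embedding.nonempty_of_card_le (by rw [Fintype.card_fin]; exact hcard)
  refine ⟨fun v => e (Quotient.mk S v), fun x y => ?_⟩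
  rw [Ne, e.injective.eq_iff, Quotient.eq]
  exact not_not.symm

lemma card_disagreements_le_comap_update {V ι : Type*} [Fintype V] [DecidableEq V]
    (G : SimpleGraph V) (x y : V) (c : V → ι) : #(disagreements G c) ≤
      #(disagreements (G.comap (Function.update id x y)) c) + 2 * Fintype.card V := by
  have h1 : disagreements G c ⊆ disagreements (G.comap (Function.update id x y)) c ∪
      (({x} : Finset V) ×ˢ univ ∪ univ ×ˢ ({x} : Finset V)) := by
    rintro ⟨v, w⟩ h
    simp only [mem_union, mem_product, mem_singleton, mem_univ, and_true, true_and]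
    by_cases hv : v = x
    · exact Or.inr (Or.inl hv)
    by_cases hw : w = x
    · exact Or.inr (Or.inr hw)
    left
    simpa [disagreements, hv, hw] using h
  refine (card_le_card h1).trans ((card_union_le _ _).trans (Nat.add_le_add_left ?_ _))
  refine (card_union_le _ _).trans ?_
  simp
  omega

lemma card_homs_le {V ι : Type*} [Fintype V] (q : W → ι) (G : SimpleGraph V) :
    #(homs q G) ≤ Fintype.card V ^ Fintype.card W := by
  rw [← Fintype.card_fun]
  exact card_le_univ _

/-- Stability in terms of homomorphism counts. -/
lemma homs_stability {k r : ℕ} (hk : 2 ≤ k) (hkr : k ≤ r) (q : W → Fin k)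
    (hq : Function.Surjective q) (hW : 2 ≤ Fintype.card W) (ε : ℝ) (hε : 0 < ε) :
    ∃ δ : ℝ, 0 < δ ∧ ∃ N : ℕ, ∀ n, N ≤ n → ∀ G : SimpleGraph (Fin n), G.CliqueFree (r + 1) →
      (∀ G' : SimpleGraph (Fin n), G'.CliqueFree (r + 1) →
        (#(homs q G') : ℝ) ≤ #(homs q G) + δ * (n : ℝ) ^ Fintype.card W) →
      ∃ c : Fin n → Fin r, (#(disagreements G c) : ℝ) ≤ ε * (n : ℝ) ^ 2 := by
  obtain ⟨ε₀, hε₀, δ₀, hδ₀, C, hC, N, hN⟩ := exists_local_stability hk hkr q hq hW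
  set ε' := min ε ε₀ with hε'
  have hε'0 : 0 < ε' := lt_min hε hε₀
  set δ := min δ₀ (ε' / (2 * C)) with hδ
  have hδ0 : 0 < δ := lt_min hδ₀ (by positivity)
  have hCδ : C * δ ≤ ε' / 2 := by
    have : δ ≤ ε' / (2 * C) := min_le_right _ _
    rw [le_div_iff₀ (by positivity)] at this
    linarith
  refine ⟨δ, hδ0, max N (⌈4 / ε'⌉₊ + 1), ?_⟩
  intro n hn G hG hmax
  have hNn : N ≤ n := (le_max_left _ _).trans hn
  have hn4 : 4 < ε' * n := by
    have h1 : 4 / ε' < n := (Nat.le_ceil _).trans_lt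
      (Nat.cast_lt.2 (Nat.lt_of_succ_le ((le_max_right _ _).trans hn)))
    rw [div_lt_iff₀ hε'0] at h1
    linarith
  have hn0 : (0 : ℝ) < n := by
    by_contra! h
    nlinarith
  by_contra! hfar
  -- The almost extremal graphs that are far from every r-partition; the aim is to show that none
  -- exists.
  let 𝒞 : Finset (SimpleGraph (Fin n)) := univ.filter fun G => G.CliqueFree (r + 1) ∧
    (∀ G' : SimpleGraph (Fin n), G'.CliqueFree (r + 1) →
      (#(homs q G') : ℝ) ≤ #(homs q G) + δ * (n : ℝ) ^ Fintype.card W) ∧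
    ∀ c : Fin n → Fin r, ε' * (n : ℝ) ^ 2 < #(disagreements G c)
  have hne : 𝒞.Nonempty := by
    refine ⟨G, mem_filter.2 ⟨mem_univ _, hG, hmax, fun c => lt_of_le_of_lt ?_ (hfar c)⟩⟩
    gcongr
    exact min_le_left _ _
  -- There are at most n³ cherry homomorphisms, so the weight n³ + 1 makes the order lexicographic:
  -- an improvement never lowers the main count.
  obtain ⟨G₁, hG₁, hbest⟩ := exists_max_image 𝒞
    (fun G => #(homs q G) * (n ^ 3 + 1) + #(homs cherry G)) hne
  obtain ⟨-, hfree, hmax₁, hfar₁⟩ := mem_filter.1 hG₁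
  by_cases htr : ∀ u v w, ¬ G₁.Adj u v → G₁.Adj u w → G₁.Adj v w
  · obtain ⟨c, hc⟩ := exists_coloring_of_transitive hfree htr
    have h0 : #(disagreements G₁ c) = 0 := by
      rw [card_eq_zero, eq_empty_iff_forall_notMem]
      intro p hp
      exact mem_disagreements.1 hp (hc _ _)
    have h1 := hfar₁ c
    rw [h0, Nat.cast_zero] at h1
    have : 0 < ε' * (n : ℝ) ^ 2 := by positivity
    linarith
  · push Not at htr
    obtain ⟨u, v, w, huv, huw, hvw⟩ := htr
    obtain ⟨x, y, -, hlt⟩ := exists_clone_increase q huv huw hvw (n ^ 3 + 1)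
    set G₂ := G₁.comap (Function.update id x y) with hG₂
    have hfree₂ : G₂.CliqueFree (r + 1) := cliqueFree_comap hfree _
    have hle : #(homs q G₁) ≤ #(homs q G₂) := by
      have h1 := card_homs_le cherry G₂
      rw [Fintype.card_fin, Fintype.card_fin] at h1
      by_contra! h2
      have h3 := Nat.mul_le_mul_right (n ^ 3 + 1) (Nat.succ_le_of_lt h2)
      rw [Nat.succ_mul] at h3
      linarith
    have hmax₂ : ∀ G' : SimpleGraph (Fin n), G'.CliqueFree (r + 1) →
        (#(homs q G') : ℝ) ≤ #(homs q G₂) + δ * (n : ℝ) ^ Fintype.card W := by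
      intro G' hG'
      refine (hmax₁ G' hG').trans ?_
      gcongr
    have hnot : G₂ ∉ 𝒞 := fun h => absurd hlt (not_lt.2 (hbest G₂ h))
    obtain ⟨c, hc⟩ : ∃ c : Fin n → Fin r, (#(disagreements G₂ c) : ℝ) ≤ ε' * (n : ℝ) ^ 2 := by
      by_contra! h
      exact hnot (mem_filter.2 ⟨mem_univ _, hfree₂, hmax₂, h⟩)
    -- The improved graph left the family, so it is close, and by the gap within ε'n²/2. Undoing the
    -- clone costs at most 2n < ε'n²/2, so `G₁` was not far.
    obtain ⟨c', hc'⟩ := hN n hNn G₂ δ hfree₂ (min_le_left _ _) hmax₂ c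
      (hc.trans (by gcongr; exact min_le_right _ _))
    have h1 := card_disagreements_le_comap_update G₁ x y c'
    rw [Fintype.card_fin] at h1
    have h1' : (#(disagreements G₁ c') : ℝ) ≤ #(disagreements G₂ c') + 2 * n := by
      exact_mod_cast h1
    have h2 := hfar₁ c'
    have h3 := mul_le_mul_of_nonneg_right hCδ (by positivity : (0 : ℝ) ≤ (n : ℝ) ^ 2)
    have h4 := mul_lt_mul_of_pos_right hn4 hn0
    nlinarith

end

/-! ### From homomorphisms to copies and edit distance. -/

section

section CopyCount

variable {V W : Type*} {G : SimpleGraph V} {H : SimpleGraph W}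

lemma toSubgraph_adj_iff (f : H.Copy G) (x y : W) :
    f.toSubgraph.Adj (f x) (f y) ↔ H.Adj x y := by
  have hinj : Function.Injective f := f.injective
  simp only [SimpleGraph.Subgraph.map_adj, Relation.Map, SimpleGraph.Copy.coe_toHom,
    SimpleGraph.Subgraph.top_adj]
  constructor
  · rintro ⟨a, b, hab, ha, hb⟩
    rwa [← hinj ha, ← hinj hb]
  · exact fun h => ⟨x, y, h, rfl, rfl⟩

/-- Both copies have the same image, so f followed by the inverse of f₀ is an automorphism of H. -/
lemma exists_iso_of_toSubgraph_eq [Finite W] {f f₀ : H.Copy G}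
    (h : f.toSubgraph = f₀.toSubgraph) : ∃ σ : H ≃g H, f₀.comp σ.toCopy = f := by
  have hmem : ∀ x, ∃ y, f₀ y = f x := by
    intro x
    have hx : f x ∈ f.toSubgraph.verts := ⟨x, trivial, rfl⟩
    rw [h] at hx
    obtain ⟨y, -, hy⟩ := hx
    exact ⟨y, hy⟩
  choose σ hσ using hmem
  have hinj : Function.Injective σ := by
    intro a b hab
    refine f.injective ?_
    change f a = f b
    rw [← hσ, ← hσ, hab]
  refine ⟨⟨Equiv.ofBijective σ (Finite.injective_iff_bijective.1 hinj), ?_⟩, ?_⟩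
  · intro a b
    rw [Equiv.ofBijective_apply, Equiv.ofBijective_apply, ← toSubgraph_adj_iff f₀, hσ, hσ, ← h,
      toSubgraph_adj_iff]
  · ext a
    rw [SimpleGraph.Copy.comp_apply]
    exact hσ a

lemma toSubgraph_comp_iso (f₀ : H.Copy G) (σ : H ≃g H) :
    (f₀.comp σ.toCopy).toSubgraph = f₀.toSubgraph := by
  have hval : ∀ a, (f₀.comp σ.toCopy) a = f₀ (σ a) := fun a => SimpleGraph.Copy.comp_apply _ _ _
  ext x y
  · simp only [SimpleGraph.Subgraph.map_verts, SimpleGraph.Subgraph.verts_top, Set.image_univ,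
      Set.mem_range, SimpleGraph.Copy.coe_toHom, hval]
    exact ⟨fun ⟨a, ha⟩ => ⟨σ a, ha⟩, fun ⟨a, ha⟩ => ⟨σ.symm a, by simpa using ha⟩⟩
  · simp only [SimpleGraph.Subgraph.map_adj, Relation.Map, SimpleGraph.Copy.coe_toHom,
      SimpleGraph.Subgraph.top_adj, hval]
    constructor
    · rintro ⟨a, b, hab, ha, hb⟩
      exact ⟨σ a, σ b, σ.map_rel_iff.2 hab, ha, hb⟩
    · rintro ⟨a, b, hab, ha, hb⟩
      exact ⟨σ.symm a, σ.symm b, σ.symm.map_rel_iff.2 hab, by simpa using ha, by simpa using hb⟩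

lemma finite_iso [Finite W] : Finite (H ≃g H) := DFunLike.finite _

lemma card_iso_pos [Finite W] : 0 < Nat.card (H ≃g H) :=
  Nat.card_pos_iff.2 ⟨⟨SimpleGraph.Iso.refl⟩, finite_iso⟩

/-- Every unlabelled copy of `H` arises from exactly `|Aut H|` labelled copies. -/
lemma labelledCopyCount_eq [Fintype V] [Fintype W] :
    G.labelledCopyCount H = G.copyCount H * Nat.card (H ≃g H) := by
  rw [SimpleGraph.labelledCopyCount, SimpleGraph.copyCount_eq_card_image_copyToSubgraph,
    ← card_univ, card_eq_sum_card_image SimpleGraph.Copy.toSubgraph univ, ← smul_eq_mul]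
  apply sum_const_nat
  intro A hA
  obtain ⟨f₀, -, rfl⟩ := mem_image.1 hA
  have : Finite (H ≃g H) := finite_iso
  have : Fintype (H ≃g H) := Fintype.ofFinite _
  rw [Nat.card_eq_fintype_card, ← card_univ]
  symm
  refine card_bij (fun σ _ => f₀.comp σ.toCopy) ?_ ?_ ?_
  · intro σ _
    exact mem_filter.2 ⟨mem_univ _, toSubgraph_comp_iso f₀ σ⟩
  · intro σ _ τ _ hστ
    ext a
    refine f₀.injective ?_
    have := DFunLike.congr_fun hστ a
    rw [SimpleGraph.Copy.comp_apply, SimpleGraph.Copy.comp_apply] at this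
    exact this
  · intro f hf
    obtain ⟨σ, hσ⟩ := exists_iso_of_toSubgraph_eq (mem_filter.1 hf).2
    exact ⟨σ, mem_univ _, hσ⟩

end CopyCount

variable {V W : Type*} [Fintype V] [Fintype W]

lemma labelledCopyCount_eq_card_homs {ι : Type*} {q : W → ι} {H : SimpleGraph W}
    (hH : ∀ u v, H.Adj u v ↔ q u ≠ q v) (G : SimpleGraph V) :
    G.labelledCopyCount H = #{φ ∈ homs q G | Function.Injective φ} := by
  rw [SimpleGraph.labelledCopyCount, ← card_univ]
  refine card_bij (fun f _ => f) ?_ ?_ ?_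
  · intro f _
    refine mem_filter.2 ⟨mem_homs.2 fun i j hij => f.toHom.map_adj ((hH i j).2 hij), f.injective⟩
  · intro f _ g _ h
    exact DFunLike.coe_injective h
  · intro φ hφ
    obtain ⟨h1, h2⟩ := mem_filter.1 hφ
    exact ⟨⟨⟨φ, fun {a b} h => mem_homs.1 h1 a b ((hH a b).1 h)⟩, h2⟩, mem_univ _, rfl⟩

/-- A non-injective map sends two distinct vertices to a diagonal pair, and there are only |V| of
those. -/
lemma card_homs_le_card_injective_add {ι : Type*} (q : W → ι) (G : SimpleGraph V)
    (hW : 2 ≤ Fintype.card W) :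
    #(homs q G) ≤ #{φ ∈ homs q G | Function.Injective φ} +
      Fintype.card W ^ 2 * Fintype.card V ^ (Fintype.card W - 1) := by
  rw [← card_filter_add_card_filter_not (s := homs q G) (fun φ => Function.Injective φ)]
  apply Nat.add_le_add_left
  have hsub : (homs q G).filter (fun φ => ¬ Function.Injective φ) ⊆
      ((univ : Finset (W × W)).filter fun p => p.1 ≠ p.2).biUnion
        fun p => univ.filter fun φ : W → V => (φ p.1, φ p.2) ∈ (univ : Finset V).image
          fun v => (v, v) := by
    intro φ hφ
    obtain ⟨-, h⟩ := mem_filter.1 hφ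
    simp only [Function.Injective, not_forall] at h
    obtain ⟨a, b, hab, hne⟩ := h
    simp only [mem_biUnion, mem_filter, mem_univ, true_and, Prod.exists, mem_image]
    exact ⟨a, b, hne, φ a, by rw [hab]⟩
  refine (card_le_card hsub).trans (card_biUnion_le.trans ?_)
  refine (sum_le_card_nsmul _ _ (Fintype.card V ^ (Fintype.card W - 1)) ?_).trans ?_
  · intro p hp
    refine (card_filter_pair_mem_le (mem_filter.1 hp).2 _).trans ?_
    have e : Fintype.card W - 1 = 1 + (Fintype.card W - 2) := by omega
    rw [e, pow_add, pow_one]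
    exact Nat.mul_le_mul_right _ card_image_le
  · rw [smul_eq_mul]
    apply Nat.mul_le_mul_right
    refine (card_le_univ _).trans ?_
    rw [Fintype.card_prod, sq]

lemma card_disagreements_le_of_eqOn_compl {ι : Type*} (G : SimpleGraph V) {c c' : V → ι}
    (S : Finset V) (h : ∀ v ∉ S, c' v = c v) :
    #(disagreements G c') ≤ #(disagreements G c) + 2 * (#S * Fintype.card V) := by
  have h1 : disagreements G c' ⊆ disagreements G c ∪ (S ×ˢ univ ∪ univ ×ˢ S) := by
    rintro ⟨v, w⟩ hp
    simp only [mem_union, mem_product, mem_univ, and_true, true_and]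
    by_cases hv : v ∈ S
    · exact Or.inr (Or.inl hv)
    by_cases hw : w ∈ S
    · exact Or.inr (Or.inr hw)
    left
    rw [mem_disagreements] at hp ⊢
    rwa [h v hv, h w hw] at hp
  refine (card_le_card h1).trans ((card_union_le _ _).trans (Nat.add_le_add_left ?_ _))
  refine (card_union_le _ _).trans ?_
  rw [card_product, card_product, card_univ, mul_comm (Fintype.card V), two_mul]

lemma editDist_partGraph_le {ι : Type*} (G : SimpleGraph V) (c : V → ι) :
    editDist G (partGraph c) ≤ #(disagreements G c) := by
  have hle : editDist G (partGraph c) ≤ (symmDiff G.edgeSet (partGraph c).edgeSet).ncard :=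
    Nat.sInf_le ⟨partGraph c, ⟨SimpleGraph.Iso.refl⟩, rfl⟩
  refine hle.trans ?_
  have hsub : symmDiff G.edgeSet (partGraph c).edgeSet ⊆
      (((disagreements G c).image fun p => s(p.1, p.2) : Finset (Sym2 V)) : Set (Sym2 V)) := by
    intro e
    induction e using Sym2.ind with
    | _ x y =>
      intro he
      simp only [Set.mem_symmDiff, SimpleGraph.mem_edgeSet, partGraph_adj] at he
      rw [mem_coe, mem_image]
      exact ⟨(x, y), mem_disagreements.2 (by simp only; tauto), rfl⟩
  refine (Set.ncard_le_ncard hsub (finite_toSet _)).trans ?_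
  rw [Set.ncard_coe_finset]
  exact card_image_le

/-- `IsCompletePartite` needs non-empty classes; giving the first r vertices distinct colours
ensures this at a cost of O(n) pairs. -/
lemma exists_surjective_coloring {n r : ℕ} (hrn : r ≤ n) (G : SimpleGraph (Fin n))
    (c : Fin n → Fin r) : ∃ c' : Fin n → Fin r, Function.Surjective c' ∧
      #(disagreements G c') ≤ #(disagreements G c) + 2 * (r * n) := by
  let c' : Fin n → Fin r := fun v => if h : v.1 < r then ⟨v.1, h⟩ else c v
  refine ⟨c', fun s => ⟨Fin.castLE hrn s, by simp [c']⟩, ?_⟩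
  have h1 := card_disagreements_le_of_eqOn_compl G (c := c) (c' := c')
    (univ.image (Fin.castLE hrn)) (by
      intro v hv
      refine dif_neg fun h => hv ?_
      exact mem_image.2 ⟨⟨v.1, h⟩, mem_univ _, rfl⟩)
  rwa [card_image_of_injective _ (Fin.castLE_injective hrn), card_univ, Fintype.card_fin,
    Fintype.card_fin] at h1

lemma copyCount_le_genExtremalNumber {U X : Type*} {n : ℕ} {F : SimpleGraph U}
    {G : SimpleGraph (Fin n)} (H : SimpleGraph X) (hG : F.Free G) :
    G.copyCount H ≤ genExtremalNumber n H F :=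
  le_sup (f := fun G : SimpleGraph (Fin n) => G.copyCount H) (mem_filter.2 ⟨mem_univ _, hG⟩)

/-- An almost extremal graph for copies is almost extremal for homomorphisms. -/
lemma card_homs_le_of_copyCount {ι : Type*} {q : W → ι} {H : SimpleGraph W}
    (hH : ∀ u v, H.Adj u v ↔ q u ≠ q v) (hW : 2 ≤ Fintype.card W) {G G' : SimpleGraph V} {δ : ℝ}
    (hV : 0 < Fintype.card V)
    (hV' : 2 * (Fintype.card W : ℝ) ^ 2 ≤ δ * Fintype.card V)
    (hle : (G'.copyCount H : ℝ) ≤ G.copyCount H +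
      δ / (2 * Nat.card (H ≃g H)) * (Fintype.card V : ℝ) ^ Fintype.card W) :
    (#(homs q G') : ℝ) ≤ #(homs q G) + δ * (Fintype.card V : ℝ) ^ Fintype.card W := by
  have hV0 : (0 : ℝ) < Fintype.card V := Nat.cast_pos.2 hV
  have hκ : 0 < Nat.card (H ≃g H) := card_iso_pos
  have hκ' : (0 : ℝ) < Nat.card (H ≃g H) := Nat.cast_pos.2 hκ
  have h1 := card_homs_le_card_injective_add q G' hW
  rw [← labelledCopyCount_eq_card_homs hH, labelledCopyCount_eq] at h1
  have h1' : (#(homs q G') : ℝ) ≤ G'.copyCount H * Nat.card (H ≃g H) +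
      (Fintype.card W : ℝ) ^ 2 * (Fintype.card V : ℝ) ^ (Fintype.card W - 1) := by
    exact_mod_cast h1
  have h2 : G.copyCount H * Nat.card (H ≃g H) ≤ #(homs q G) := by
    rw [← labelledCopyCount_eq, labelledCopyCount_eq_card_homs hH]
    exact card_filter_le _ _
  have h2' : (G.copyCount H : ℝ) * Nat.card (H ≃g H) ≤ #(homs q G) := by exact_mod_cast h2
  have h3 := mul_le_mul_of_nonneg_right hle hκ'.le
  have h4 : δ / (2 * Nat.card (H ≃g H)) * (Fintype.card V : ℝ) ^ Fintype.card W *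
      Nat.card (H ≃g H) = δ / 2 * (Fintype.card V : ℝ) ^ Fintype.card W := by
    field_simp
  have h5 : (Fintype.card V : ℝ) ^ Fintype.card W =
      Fintype.card V * (Fintype.card V : ℝ) ^ (Fintype.card W - 1) := by
    rw [← pow_succ']; congr 1; omega
  have h6 : (Fintype.card W : ℝ) ^ 2 * (Fintype.card V : ℝ) ^ (Fintype.card W - 1) ≤
      δ / 2 * (Fintype.card V : ℝ) ^ Fintype.card W := by
    rw [h5, ← mul_assoc]
    gcongr
    linarith
  rw [add_mul, h4] at h3
  linarith

end

end PartiteStability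

open PartiteStability Finset in
theorem theorem1 {W : Type*} [Fintype W] (H : SimpleGraph W) (k r : ℕ) (hk : 2 ≤ k)
    (hH : IsCompletePartite H k) (hr : k ≤ r) :
    WeaklyTuranStable H (SimpleGraph.completeGraph (Fin (r + 1))) := by
  obtain ⟨q, hq, hadj⟩ := hH
  have hW : 2 ≤ Fintype.card W := by
    have := Fintype.card_le_of_surjective q hq
    rw [Fintype.card_fin] at this
    omega
  refine ⟨r, ?_, ?_, ?_⟩
  · rw [SimpleGraph.completeGraph_eq_top, SimpleGraph.chromaticNumber_top, Fintype.card_fin]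
    norm_cast
  · have h1 : H.Colorable k := ⟨SimpleGraph.Coloring.mk q fun {u v} h => (hadj u v).1 h⟩
    exact SimpleGraph.chromaticNumber_le_iff_colorable.2 (h1.mono hr)
  intro ε hε
  obtain ⟨δ, hδ, N, hN⟩ := homs_stability hk hr q hq hW (ε / 2) (half_pos hε)
  have hκ : 0 < Nat.card (H ≃g H) := card_iso_pos
  -- Division by |Aut H| converts copies to injective homomorphisms, and half of δ is kept for the
  -- non-injective ones. The last threshold gives 2rn ≤ εn²/2, which pays for making the colouring
  -- surjective.
  refine ⟨δ / (2 * Nat.card (H ≃g H)), by positivity,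
    max (max N (r + 1)) (max ⌈2 * (Fintype.card W : ℝ) ^ 2 / δ⌉₊ ⌈4 * r / ε⌉₊), ?_⟩
  intro n hn G hG hcount
  simp only [max_le_iff, Nat.ceil_le] at hn
  obtain ⟨⟨hNn, hrn⟩, hδn, hεn⟩ := hn
  rw [div_le_iff₀ hδ] at hδn
  rw [div_le_iff₀ hε] at hεn
  have hfree : ∀ G' : SimpleGraph (Fin n), G'.CliqueFree (r + 1) ↔
      (SimpleGraph.completeGraph (Fin (r + 1))).Free G' := by
    intro G'
    rw [SimpleGraph.Free, ← SimpleGraph.not_cliqueFree_iff_top_isContained, not_not]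
  obtain ⟨c, hc⟩ := hN n hNn G ((hfree G).2 hG) (by
    intro G' hG'
    have h1 : (G'.copyCount H : ℝ) ≤
        genExtremalNumber n H (SimpleGraph.completeGraph (Fin (r + 1))) :=
      Nat.cast_le.2 (copyCount_le_genExtremalNumber H ((hfree G').1 hG'))
    have h2 := card_homs_le_of_copyCount (G := G) (G' := G') hadj hW (δ := δ)
      (by rw [Fintype.card_fin]; omega) (by rw [Fintype.card_fin]; linarith)
      (by rw [Fintype.card_fin]; linarith)
    rwa [Fintype.card_fin] at h2)
  obtain ⟨c', hc', hcard⟩ := exists_surjective_coloring (by omega) G c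
  refine ⟨partGraph c', ⟨c', hc', fun u v => partGraph_adj⟩, ?_⟩
  have h1 : (editDist G (partGraph c') : ℝ) ≤ #(disagreements G c) + 2 * (r * n) := by
    exact_mod_cast (editDist_partGraph_le G c').trans hcard
  have h2 := mul_le_mul_of_nonneg_right hεn (Nat.cast_nonneg n : (0 : ℝ) ≤ n)
  nlinarith
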